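/- For integers $n\ge 1$ let $\mathcal B_n=\{a\in\mathbb Z:\ 2^{n-1}\le a<2^n,\ a\text{ odd}\}$, and for $a=\sum_{j=0}^{n-1}\varepsilon_j 2^j\in\mathcal B_n$ with $\varepsilon_j\in\{0,1\}$ let $\overleftarrow{a}=\sum_{j=0}^{n-1}\varepsilon_j 2^{n-1-j}$ be its binary reversal. Let $f$ be the multiplicative function with $f(2)=0$, $f(3)=1$, $f(p)=\frac{2p-1}{p}$ for primes $p\ge 5$, and $f(p^\nu)=0$ for all primes $p$ and all $\nu\ge 2$. For squarefree $d\ge 1$ define $R_n(d)$ by $$|\{a\in\mathcal B_n:\ d\mid a\,\overleftarrow{a}\}|=\frac{f(d)}{d}\,|\mathcal B_n|+R_n(d).$$ Let $0<\xi<1/2$. There exist $c>0$ and $C>0$, depending only on $\xi$, such that for every integer $n\ge 1$, $$\sum_{\substack{1\le d<2^{\xi n}\\ d\text{ odd}}}\mu^2(d)\,4^{\omega(d)}\,|R_n(d)|\le C\,2^n\exp(-c\sqrt n),$$ where $\mu$ is the M\"obius function and $\omega(d)$ is the number of distinct prime factors of $d$. -/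

import Mathlib

namespace ReversiblePrimes

/-- The set of `n`-bit odd integers (meant for `1 ≤ n`). -/
def oddBits (n : ℕ) : Finset ℕ :=
  (Finset.Ico (2 ^ (n - 1)) (2 ^ n)).filter Odd

/-- The reverse of the `n`-bit integer `a`: if `a = ∑ ε_j 2^j` then this is `∑ ε_j 2^(n-1-j)`,
the sums being over `0 ≤ j < n`, with `ε_j = a / 2^j % 2` the binary digits of `a`. -/
def mirror (n a : ℕ) : ℕ :=
  ∑ j ∈ Finset.range n, (a / 2 ^ j % 2) * 2 ^ (n - 1 - j)

/-- The number of `n`-bit odd integers `a` such that `d` divides `a` times its reverse. -/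
def T (n d : ℕ) : ℕ :=
  ((oddBits n).filter (fun a => d ∣ a * mirror n a)).card

/-- The values at the primes of the multiplicative function `f`. -/
noncomputable def fPrime (p : ℕ) : ℝ :=
  if p = 2 then 0 else if p = 3 then 1 else (2 * (p : ℝ) - 1) / p

/-- The multiplicative function with `f p = fPrime p` for `p` prime and
`f (p ^ k) = 0` for `k ≥ 2`. -/
noncomputable def f : ArithmeticFunction ℝ where
  toFun d := if d = 0 then 0 else d.factorization.prod (fun p k => if k = 1 then fPrime p else 0)
  map_zero' := by simp

/-- The error term: `T n d = f d / d * |B_n| + R n d`. -/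
noncomputable def R (n d : ℕ) : ℝ :=
  (T n d : ℝ) - f d / d * ((oddBits n).card : ℝ)

/-- The odd natural numbers that are less than the real number `x`. -/
noncomputable def oddBelow (x : ℝ) : Finset ℕ :=
  (Finset.range ⌈x⌉₊).filter Odd

theorem mem_oddBelow (x : ℝ) (d : ℕ) : d ∈ oddBelow x ↔ (d : ℝ) < x ∧ Odd d := by
  simp [oddBelow, Nat.lt_ceil]

end ReversiblePrimes

/-! The condition d ∣ a·rev(a) splits, by e = gcd(a, d) and Möbius inversion, into conditions q₁ ∣
a, q₂ ∣ rev(a) with lcm(q₁, q₂) = d. Additive characters turn these into exponential sums. Both a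
and rev(a) are linear in the same free digits, so the sum at frequencies (x, y) factors and is at
most 2^n ∏ |cos π(x 2^j + y 2^(n-1-j))| over the inner digits (`norm_expSum_le`). The prime 3 is
split off as κ ∈ {1, 3}: since 2 ≡ -1 mod 3, it divides a exactly when it divides rev(a).
Frequencies with x a multiple of 1/κ and y = 0 give the main term. It remains to average the product
of cosines over reduced fractions x = k₁/r₁, y = k₂/r₂ with lcm(r₁, r₂) < 2^(ξn) and r₁, r₂ not both
dividing 3.

Why ξ < 1/2 suffices: put g = gcd(r₁, r₂), rᵢ = g sᵢ, with sᵢ of size 2^(iᵢ). Fractions of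
denominators g s with s < 2^(i+1) are spaced by 1/(g 4^(i+1)), so a large sieve for them consumes
about log₂ g + 2i digits. The low digits serve x and the high digits serve y, the other variable
being an arbitrary phase. Together they use about 2 log₂(g 2^(i₁+i₂)) ≤ 2ξn digits, so a positive
proportion of the digits is left in the middle; Cauchy-Schwarz combines the three ranges
(`bilinear_kern_sq_le`).

The middle digits give the saving. If u, v are the phases at digits j+1 and j, then 2u - v = 3·2^j x
no longer involves y, and the two cosines together are at most 1 - sin²(3π 2^j x)/10. If r ≥ 2^L,
the large sieve averages this to 19/20 per digit; if r < 2^L and r ∤ 3, repeated doubling pushes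
3·2^j k/r far from the integers once in every 2L digits (`sum_dampProd_le`). Balancing at L of order
√n yields exp(-c√n); all divisor weights cost only powers of n. -/

namespace ReversiblePrimes

/-! ### Large sieve on dyadic intervals for products along the doubling map. -/

open Real in
/-- One point in every dyadic interval of length `2⁻ᵐ`. -/
theorem sum_prod_dyadic_le (m : ℕ) :
    ∀ (φ : ℕ → ℝ → ℝ) (l : ℕ → ℝ), (∀ j x, 0 ≤ φ j x) → (∀ j x, φ j (x + 1) = φ j x) →
      (∀ j, 0 ≤ l j) →
      (∀ j x y, φ j x + φ j (y + 1 / 2) ≤ l j * (1 + π * |x - y|)) →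
      ∀ y : ℕ → ℝ, (∀ i : ℕ, i < 2 ^ m → (i : ℝ) / 2 ^ m ≤ y i ∧ y i ≤ ((i : ℝ) + 1) / 2 ^ m) →
      ∑ i ∈ Finset.range (2 ^ m), ∏ j ∈ Finset.range m, φ j (2 ^ j * y i) ≤
        (∏ j ∈ Finset.range m, l j) * exp (π * (1 - 1 / 2 ^ m)) := by
  induction m with
  | zero => intro φ l _ _ _ _ y _; simp
  | succ m ih =>
    intro φ l h0 hp hl hpair y hy
    set Q : ℝ → ℝ := fun z => ∏ j ∈ Finset.range m, φ (j + 1) (2 ^ j * z) with hQ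
    have hQ0 : ∀ z, 0 ≤ Q z := fun z => Finset.prod_nonneg fun j _ => h0 _ _
    have hpn : ∀ j (k : ℕ) x, φ j (x + k) = φ j x := by
      intro j k x
      induction k with
      | zero => simp
      | succ k ih => push_cast; rw [← add_assoc, hp, ih]
    have hQp : ∀ z, Q (z + 1) = Q z := by
      intro z
      refine Finset.prod_congr rfl fun j _ => ?_
      have := hpn (j + 1) (2 ^ j) (2 ^ j * z)
      rw [← this]; push_cast; ring_nf
    have hterm : ∀ x, ∏ j ∈ Finset.range (m + 1), φ j (2 ^ j * x) = Q (2 * x) * φ 0 x := by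
      intro x
      rw [Finset.prod_range_succ', hQ]
      simp only [pow_succ, pow_zero, one_mul, mul_assoc]
    have h2 : (0 : ℝ) < 2 ^ m := by positivity
    -- The intervals i and 2^m + i differ by a shift of 1/2, so they coincide after doubling.
    -- Keeping the doubled point with the larger `Q` leaves one point in each interval of length
    -- 2⁻ᵐ, ready for the induction.
    set z : ℕ → ℝ := fun i =>
      if Q (2 * (y (2 ^ m + i) - 1 / 2)) ≤ Q (2 * y i) then 2 * y i
        else 2 * (y (2 ^ m + i) - 1 / 2) with hz
    have hb1 : ∀ i : ℕ, i < 2 ^ m → (i : ℝ) / 2 ^ m ≤ 2 * y i ∧ 2 * y i ≤ ((i : ℝ) + 1) / 2 ^ m := by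
      intro i hi
      have := hy i (by rw [pow_succ]; omega)
      rw [pow_succ, ← div_div, ← div_div] at this
      constructor <;> linarith [this.1, this.2]
    have hb2 : ∀ i : ℕ, i < 2 ^ m → (i : ℝ) / 2 ^ m ≤ 2 * (y (2 ^ m + i) - 1 / 2) ∧
        2 * (y (2 ^ m + i) - 1 / 2) ≤ ((i : ℝ) + 1) / 2 ^ m := by
      intro i hi
      have := hy (2 ^ m + i) (by rw [pow_succ]; omega)
      push_cast at this
      rw [pow_succ, ← div_div, ← div_div, add_assoc, add_div, add_div (2 ^ m : ℝ),
        div_self h2.ne'] at this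
      constructor <;> linarith [this.1, this.2]
    have hstep : ∀ i ∈ Finset.range (2 ^ m),
        ∏ j ∈ Finset.range (m + 1), φ j (2 ^ j * y i) +
          ∏ j ∈ Finset.range (m + 1), φ j (2 ^ j * y (2 ^ m + i)) ≤
        Q (z i) * (l 0 * (1 + π * (1 / 2 ^ (m + 1)))) := by
      intro i hi
      rw [Finset.mem_range] at hi
      rw [hterm, hterm]
      have e1 : Q (2 * y (2 ^ m + i)) = Q (2 * (y (2 ^ m + i) - 1 / 2)) := by
        rw [← hQp (2 * (y (2 ^ m + i) - 1 / 2))]; ring_nf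
      have q1 : Q (2 * y i) ≤ Q (z i) := by
        simp only [hz]; split_ifs with h
        · exact le_rfl
        · exact (not_le.1 h).le
      have q2 : Q (2 * (y (2 ^ m + i) - 1 / 2)) ≤ Q (z i) := by
        simp only [hz]; split_ifs with h
        · exact h
        · exact le_rfl
      have hd : |y i - (y (2 ^ m + i) - 1 / 2)| ≤ 1 / 2 ^ (m + 1) := by
        have a1 := hb1 i hi
        have a2 := hb2 i hi
        rw [add_div] at a1 a2
        rw [pow_succ, ← div_div, abs_le]
        constructor <;> linarith [a1.1, a1.2, a2.1, a2.2]
      have hpr := hpair 0 (y i) (y (2 ^ m + i) - 1 / 2)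
      rw [sub_add_cancel] at hpr
      rw [e1]
      calc _ ≤ Q (z i) * φ 0 (y i) + Q (z i) * φ 0 (y (2 ^ m + i)) := by
            gcongr
            · exact h0 _ _
            · exact h0 _ _
        _ = Q (z i) * (φ 0 (y i) + φ 0 (y (2 ^ m + i))) := by ring
        _ ≤ _ := by
            refine mul_le_mul_of_nonneg_left (hpr.trans ?_) (hQ0 _)
            have := hl 0
            gcongr
    have hsum : ∑ i ∈ Finset.range (2 ^ (m + 1)), ∏ j ∈ Finset.range (m + 1), φ j (2 ^ j * y i) =
        ∑ i ∈ Finset.range (2 ^ m), (∏ j ∈ Finset.range (m + 1), φ j (2 ^ j * y i) +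
          ∏ j ∈ Finset.range (m + 1), φ j (2 ^ j * y (2 ^ m + i))) := by
      rw [pow_succ, mul_two, Finset.sum_range_add, Finset.sum_add_distrib]
    rw [hsum]
    refine (Finset.sum_le_sum hstep).trans ?_
    rw [← Finset.sum_mul]
    have hI := ih (fun j => φ (j + 1)) (fun j => l (j + 1)) (fun _ _ => h0 _ _) (fun _ _ => hp _ _)
      (fun _ => hl _) (fun _ _ _ => hpair _ _ _) z (by
        intro i hi
        simp only [hz]; split_ifs
        · exact hb1 i hi
        · exact hb2 i hi)
    -- The distortions 1 + π/2^k, each at most exp(π/2^k), accumulate to a geometric series in the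
    -- exponent.
    have hexp : (1 + π * (1 / 2 ^ (m + 1))) * exp (π * (1 - 1 / 2 ^ m)) ≤
        exp (π * (1 - 1 / 2 ^ (m + 1))) := by
      have : π * (1 - 1 / 2 ^ (m + 1)) = π * (1 / 2 ^ (m + 1)) + π * (1 - 1 / 2 ^ m) := by
        field_simp; ring
      rw [this, exp_add]
      gcongr
      rw [add_comm]; exact add_one_le_exp _
    have hc : 0 ≤ l 0 * (1 + π * (1 / 2 ^ (m + 1))) := by
      have := hl 0; positivity
    refine (mul_le_mul_of_nonneg_right hI hc).trans ?_
    rw [Finset.prod_range_succ']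
    have hP : 0 ≤ ∏ j ∈ Finset.range m, l (j + 1) := Finset.prod_nonneg fun j _ => hl _
    calc _ = ((∏ j ∈ Finset.range m, l (j + 1)) * l 0) *
          ((1 + π * (1 / 2 ^ (m + 1))) * exp (π * (1 - 1 / 2 ^ m))) := by ring
      _ ≤ _ := mul_le_mul_of_nonneg_left hexp (mul_nonneg hP (hl 0))

open Real in
/-- Points in `[0, 1)` of which every dyadic interval of length `2⁻ᵐ` contains at most `K`. -/
theorem sum_prod_dyadic_points_le {ι : Type*} (m : ℕ) (φ : ℕ → ℝ → ℝ) (l : ℕ → ℝ)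
    (h0 : ∀ j x, 0 ≤ φ j x) (hp : ∀ j x, φ j (x + 1) = φ j x) (hl : ∀ j, 0 ≤ l j)
    (hpair : ∀ j x y, φ j x + φ j (y + 1 / 2) ≤ l j * (1 + π * |x - y|))
    (X : Finset ι) (α : ι → ℝ) (hα : ∀ x ∈ X, 0 ≤ α x ∧ α x < 1) (K : ℝ)
    (hK : ∀ i : ℕ, ((X.filter fun x => ⌊2 ^ m * α x⌋₊ = i).card : ℝ) ≤ K) :
    ∑ x ∈ X, ∏ j ∈ Finset.range m, φ j (2 ^ j * α x) ≤
      K * ((∏ j ∈ Finset.range m, l j) * exp π) := by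
  classical
  set Q : ℝ → ℝ := fun z => ∏ j ∈ Finset.range m, φ j (2 ^ j * z) with hQ
  have hQ0 : ∀ z, 0 ≤ Q z := fun z => Finset.prod_nonneg fun j _ => h0 _ _
  have h2 : (0 : ℝ) < 2 ^ m := by positivity
  have hK0 : 0 ≤ K := le_trans (Nat.cast_nonneg _) (hK 0)
  -- Each interval is represented by its point with the largest product, or by its left endpoint if
  -- it is empty.
  have key : ∀ i : ℕ, ∃ y : ℝ, (i : ℝ) / 2 ^ m ≤ y ∧ y ≤ ((i : ℝ) + 1) / 2 ^ m ∧
      ∀ x ∈ X.filter (fun x => ⌊2 ^ m * α x⌋₊ = i), Q (α x) ≤ Q y := by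
    intro i
    rcases (X.filter fun x => ⌊2 ^ m * α x⌋₊ = i).eq_empty_or_nonempty with h | h
    · refine ⟨(i : ℝ) / 2 ^ m, le_rfl, by gcongr; linarith, ?_⟩
      rw [h]; simp
    · obtain ⟨x, hx, hmax⟩ := Finset.exists_max_image _ (fun x => Q (α x)) h
      refine ⟨α x, ?_, ?_, hmax⟩
      · rw [Finset.mem_filter] at hx
        rw [div_le_iff₀ h2, ← hx.2, mul_comm (α x)]
        exact Nat.floor_le (mul_nonneg h2.le (hα x hx.1).1)
      · rw [Finset.mem_filter] at hx
        rw [le_div_iff₀ h2, ← hx.2, mul_comm (α x)]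
        exact (Nat.lt_floor_add_one _).le
  choose y hy1 hy2 hy3 using key
  have hmaps : ∀ x ∈ X, ⌊2 ^ m * α x⌋₊ ∈ Finset.range (2 ^ m) := by
    intro x hx
    rw [Finset.mem_range, Nat.floor_lt (mul_nonneg h2.le (hα x hx).1)]
    push_cast
    have := (hα x hx).2
    nlinarith
  rw [← Finset.sum_fiberwise_of_maps_to hmaps]
  have hle : ∀ i ∈ Finset.range (2 ^ m),
      ∑ x ∈ X.filter (fun x => ⌊2 ^ m * α x⌋₊ = i), Q (α x) ≤ K * Q (y i) := by
    intro i _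
    refine (Finset.sum_le_card_nsmul _ _ _ (hy3 i)).trans ?_
    rw [nsmul_eq_mul]
    exact mul_le_mul_of_nonneg_right (hK i) (hQ0 _)
  refine (Finset.sum_le_sum hle).trans ?_
  rw [← Finset.mul_sum]
  refine mul_le_mul_of_nonneg_left ?_ hK0
  refine (sum_prod_dyadic_le m φ l h0 hp hl hpair y fun i _ => ⟨hy1 i, hy2 i⟩).trans ?_
  refine mul_le_mul_of_nonneg_left ?_ (Finset.prod_nonneg fun j _ => hl j)
  rw [exp_le_exp]
  have : 0 < 1 / (2 : ℝ) ^ m := by positivity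
  nlinarith [pi_pos]

/-! ### Pair inequalities for cosines and for the damping factor. -/

theorem sin_sq_sub_sin_sq_le (A B : ℝ) : Real.sin A ^ 2 - Real.sin B ^ 2 ≤ |A - B| := by
  have h : Real.sin A ^ 2 - Real.sin B ^ 2 = Real.sin (A + B) * Real.sin (A - B) := by
    rw [Real.sin_add, Real.sin_sub]
    linear_combination (-Real.sin A ^ 2) * Real.sin_sq_add_cos_sq B +
      Real.sin B ^ 2 * Real.sin_sq_add_cos_sq A
  rw [h]
  calc _ ≤ |Real.sin (A + B) * Real.sin (A - B)| := le_abs_self _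
    _ = |Real.sin (A + B)| * |Real.sin (A - B)| := abs_mul _ _
    _ ≤ 1 * |A - B| := by
        exact mul_le_mul (Real.abs_sin_le_one _) Real.abs_sin_le_abs (abs_nonneg _) zero_le_one
    _ = _ := one_mul _

open Real in
-- A shift by 1/2 turns the cosine into a sine, so at x = y the squares add up to exactly 1. The
-- phase θ is arbitrary, which later allows the other frequency to be frozen.
theorem cos_sq_pair_le (θ x y : ℝ) :
    cos (π * (x + θ)) ^ 2 + cos (π * (y + 1 / 2 + θ)) ^ 2 ≤ 1 * (1 + π * |x - y|) := by
  have h1 : cos (π * (y + 1 / 2 + θ)) = - sin (π * (y + θ)) := by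
    rw [← cos_add_pi_div_two]; ring_nf
  have h2 := sin_sq_sub_sin_sq_le (π * (y + θ)) (π * (x + θ))
  have h3 : |π * (y + θ) - π * (x + θ)| = π * |x - y| := by
    rw [← mul_sub, abs_mul, abs_of_pos pi_pos, abs_sub_comm]; ring_nf
  rw [h1]
  rw [h3] at h2
  nlinarith [sin_sq_add_cos_sq (π * (x + θ))]

/-- A majorant of products of two cosines. -/
noncomputable def damp (t : ℝ) : ℝ := 1 - Real.sin (Real.pi * t) ^ 2 / 10

theorem damp_nonneg (t : ℝ) : 0 ≤ damp t := by
  have := Real.sin_sq_le_one (Real.pi * t)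
  unfold damp; linarith

theorem damp_le_one (t : ℝ) : damp t ≤ 1 := by
  have := sq_nonneg (Real.sin (Real.pi * t))
  unfold damp; linarith

theorem damp_add_one (t : ℝ) : damp (t + 1) = damp t := by
  unfold damp
  rw [mul_add, mul_one, Real.sin_add_pi, neg_sq]

theorem damp_add_nat (t : ℝ) (k : ℕ) : damp (t + k) = damp t := by
  induction k with
  | zero => simp
  | succ k ih => push_cast; rw [← add_assoc, damp_add_one, ih]

open Real in
-- The shift by 1/2 moves the argument by 3/2 and again exchanges sine and cosine. The pair total
-- drops from the trivial 2 to 2 - 1/10: a factor 19/20 per digit on average.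
theorem damp_pair_le (x y : ℝ) :
    damp (3 * x) + damp (3 * (y + 1 / 2)) ≤ 19 / 10 * (1 + π * |x - y|) := by
  unfold damp
  have h1 : sin (π * (3 * (y + 1 / 2))) = - cos (π * (3 * y)) := by
    have : π * (3 * (y + 1 / 2)) = π * (3 * y) + π / 2 + π := by ring
    rw [this, sin_add_pi, sin_add_pi_div_two]
  have h2 := sin_sq_sub_sin_sq_le (π * (3 * y)) (π * (3 * x))
  have h3 : |π * (3 * y) - π * (3 * x)| = 3 * (π * |x - y|) := by
    have : π * (3 * y) - π * (3 * x) = 3 * π * (y - x) := by ring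
    rw [this, abs_mul, abs_of_pos (by positivity), abs_sub_comm]; ring
  have h4 : 0 ≤ π * |x - y| := by positivity
  rw [h1]
  rw [h3] at h2
  nlinarith [sin_sq_add_cos_sq (π * (3 * y))]

open Real in
-- Both cosines can be near 1 in modulus only if u and v, hence 2u - v, are near integers. From |sin
-- π(2u - v)| ≤ 2|sin πu| + |sin πv|, Cauchy-Schwarz gives the constant 5, and the
-- arithmetic-geometric mean inequality doubles it to 10.
theorem abs_cos_mul_abs_cos_le_damp (u v : ℝ) :
    |cos (π * u)| * |cos (π * v)| ≤ damp (2 * u - v) := by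
  have h1 : sin (π * (2 * u - v)) ^ 2 ≤ 5 * (sin (π * u) ^ 2 + sin (π * v) ^ 2) := by
    have e : π * (2 * u - v) = 2 * (π * u) - π * v := by ring
    have h : |sin (π * (2 * u - v))| ≤ 2 * |sin (π * u)| + |sin (π * v)| := by
      rw [e, sin_sub, sin_two_mul]
      refine (abs_sub_le _ 0 _).trans ?_
      simp only [sub_zero, zero_sub, abs_neg, abs_mul, abs_two]
      have a1 := abs_cos_le_one (π * u)
      have a2 := abs_cos_le_one (π * v)
      have a3 := abs_cos_le_one (2 * (π * u))
      have b1 : 2 * |sin (π * u)| * |cos (π * u)| * |cos (π * v)| ≤ 2 * |sin (π * u)| * 1 * 1 := by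
        gcongr
      have b2 : |cos (2 * (π * u))| * |sin (π * v)| ≤ 1 * |sin (π * v)| := by gcongr
      linarith
    have := pow_le_pow_left₀ (abs_nonneg _) h 2
    rw [sq_abs] at this
    rw [← sq_abs (sin (π * u)), ← sq_abs (sin (π * v))]
    nlinarith [sq_nonneg (|sin (π * u)| - 2 * |sin (π * v)|)]
  have h2 : |cos (π * u)| * |cos (π * v)| ≤ (cos (π * u) ^ 2 + cos (π * v) ^ 2) / 2 := by
    rw [← sq_abs (cos (π * u)), ← sq_abs (cos (π * v))]
    nlinarith [sq_nonneg (|cos (π * u)| - |cos (π * v)|)]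
  unfold damp
  nlinarith [sin_sq_add_cos_sq (π * u), sin_sq_add_cos_sq (π * v)]

open Real in
/-- A large sieve inequality for products of cosines. -/
theorem sum_prod_cos_sq_le {ι : Type*} (m : ℕ) (hm : 1 ≤ m) (θ : ℕ → ℝ) (X : Finset ι) (α : ι → ℝ)
    (hα : ∀ x ∈ X, 0 ≤ α x ∧ α x < 1)
    (hsep : ∀ x ∈ X, ∀ y ∈ X, x ≠ y → 1 / 2 ^ m ≤ |α x - α y|) :
    ∑ x ∈ X, ∏ j ∈ Finset.Ico 1 m, cos (π * (α x * 2 ^ j + θ j)) ^ 2 ≤ 2 * exp π := by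
  classical
  have h2 : (0 : ℝ) < 2 ^ m := by positivity
  have := sum_prod_dyadic_points_le m
    -- Digit 0 is forced to be 1 in odd integers and supplies no cosine. The trivial factor there,
    -- with pair bound 2, is the source of the 2 in the result.
    (fun j x => if j = 0 then 1 else cos (π * (x + θ j)) ^ 2) (fun j => if j = 0 then 2 else 1)
    (fun j x => by split_ifs <;> positivity)
    (fun j x => by
      split_ifs
      · rfl
      · have : π * (x + 1 + θ j) = π * (x + θ j) + π := by ring
        rw [this, cos_add_pi, neg_sq])
    (fun j => by split_ifs <;> norm_num)
    (fun j x y => by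
      split_ifs
      · have : 0 ≤ π * |x - y| := by positivity
        linarith
      · exact cos_sq_pair_le _ _ _) X α hα 1 (by
      intro i
      rw [Nat.cast_le_one, Finset.card_le_one]
      intro x hx y hy
      by_contra hne
      rw [Finset.mem_filter] at hx hy
      have hs := hsep x hx.1 y hy.1 hne
      have f1 := Nat.floor_le (mul_nonneg h2.le (hα x hx.1).1)
      have f2 := Nat.lt_floor_add_one (2 ^ m * α x)
      have f3 := Nat.floor_le (mul_nonneg h2.le (hα y hy.1).1)
      have f4 := Nat.lt_floor_add_one (2 ^ m * α y)
      rw [hx.2] at f1 f2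
      rw [hy.2] at f3 f4
      have : |α x - α y| < 1 / 2 ^ m := by
        rw [lt_div_iff₀ h2, ← abs_of_pos h2, ← abs_mul, abs_lt]
        constructor <;> linarith
      linarith)
  obtain ⟨m, rfl⟩ : ∃ k, m = k + 1 := ⟨m - 1, by omega⟩
  rw [one_mul, Finset.prod_range_succ'] at this
  simp only [Nat.add_eq_zero_iff, one_ne_zero, and_false, if_false, if_true, Finset.prod_const_one,
    one_mul] at this
  refine le_trans (le_of_eq ?_) this
  refine Finset.sum_congr rfl fun x _ => ?_
  rw [Finset.prod_range_succ', Finset.prod_Ico_eq_prod_range]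
  simp only [if_true, one_mul, Nat.add_sub_cancel, add_comm 1, Nat.add_eq_zero_iff, one_ne_zero,
    and_false, if_false, mul_comm]

/-! ### Damping at reduced fractions. -/

/-- The damping factor of the window `[a, a + M)`. -/
noncomputable def dampProd (a M : ℕ) (x : ℝ) : ℝ :=
  ∏ j ∈ Finset.range M, damp (3 * (x * 2 ^ (a + j)))

theorem dampProd_nonneg (a M : ℕ) (x : ℝ) : 0 ≤ dampProd a M x :=
  Finset.prod_nonneg fun _ _ => damp_nonneg _

theorem dampProd_le_one (a M : ℕ) (x : ℝ) : dampProd a M x ≤ 1 :=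
  Finset.prod_le_one (fun _ _ => damp_nonneg _) fun _ _ => damp_le_one _

theorem dampProd_add (a M N : ℕ) (x : ℝ) :
    dampProd a (M + N) x = dampProd a M x * dampProd (a + M) N x := by
  simp only [dampProd, Finset.prod_range_add, add_assoc]

theorem dampProd_anti {a M N : ℕ} (h : M ≤ N) (x : ℝ) : dampProd a N x ≤ dampProd a M x := by
  obtain ⟨k, rfl⟩ := Nat.exists_eq_add_of_le h
  rw [dampProd_add]
  exact mul_le_of_le_one_right (dampProd_nonneg _ _ _) (dampProd_le_one _ _ _)

/-- Moving the window by a multiplies the numerator by 2^a, and periodicity leaves only its residue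
mod r. For odd r this permutes residues, so sums over all k may start at digit 0. -/
theorem dampProd_mod (a M r k : ℕ) (hr : 0 < r) :
    dampProd a M ((k : ℝ) / r) = dampProd 0 M (((2 ^ a * k % r : ℕ) : ℝ) / r) := by
  refine Finset.prod_congr rfl fun j _ => ?_
  have h : (2 ^ a * k : ℕ) = r * (2 ^ a * k / r) + 2 ^ a * k % r := (Nat.div_add_mod _ _).symm
  have h' : (2 : ℝ) ^ a * k = r * (2 ^ a * k / r : ℕ) + ((2 ^ a * k % r : ℕ) : ℝ) := by
    exact_mod_cast h
  have hr' : (r : ℝ) ≠ 0 := by positivity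
  rw [← damp_add_nat (3 * (((2 ^ a * k % r : ℕ) : ℝ) / r * 2 ^ (0 + j)))
    (3 * 2 ^ j * (2 ^ a * k / r))]
  congr 1
  push_cast only [Nat.cast_mul, Nat.cast_pow, Nat.cast_ofNat]
  rw [pow_add, zero_add]
  field_simp
  linear_combination h'

theorem sum_range_mul_mod_le (r u : ℕ) (hu : r.Coprime u) (G : ℕ → ℝ)
    (hG : ∀ k, 0 ≤ G k) : ∑ k ∈ Finset.range r, G (u * k % r) ≤ ∑ k ∈ Finset.range r, G k := by
  have hinj : Set.InjOn (fun k => u * k % r) (Finset.range r : Set ℕ) := by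
    intro x hx y hy hxy
    simp only [Finset.coe_range, Set.mem_Iio] at hx hy
    have h1 : x ≡ y [MOD r] := Nat.ModEq.cancel_left_of_coprime hu hxy
    exact Nat.ModEq.eq_of_lt_of_lt h1 hx hy
  rw [← Finset.sum_image hinj]
  refine Finset.sum_le_sum_of_subset_of_nonneg ?_ fun _ _ _ => hG _
  intro k hk
  obtain ⟨x, hx, rfl⟩ := Finset.mem_image.1 hk
  exact Finset.mem_range.2 (Nat.mod_lt _ (Nat.zero_lt_of_lt (Finset.mem_range.1 hx)))

theorem sum_dampProd_le_of_pow_le {r L : ℕ} (a : ℕ) (hr : Odd r) (hL : 2 ^ L ≤ r) :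
    ∑ k ∈ Finset.range r, dampProd a L ((k : ℝ) / r) ≤
      r * (2 * Real.exp Real.pi * (19 / 20) ^ L) := by
  have hr0 : 0 < r := hr.pos
  have hr' : (0 : ℝ) < r := by exact_mod_cast hr0
  have h2 : (0 : ℝ) < 2 ^ L := by positivity
  have h2r : (2 : ℝ) ^ L ≤ r := by exact_mod_cast hL
  simp only [dampProd_mod a L r _ hr0]
  refine (sum_range_mul_mod_le r (2 ^ a) ((Nat.coprime_two_right.2 hr).pow_right a)
    (fun k => dampProd 0 L ((k : ℝ) / r)) fun k => dampProd_nonneg _ _ _).trans ?_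
  have := sum_prod_dyadic_points_le L (fun _ x => damp (3 * x)) (fun _ => 19 / 10)
    (fun _ _ => damp_nonneg _)
    (fun _ x => by
      have := damp_add_nat (3 * x) 3
      rw [← this]; push_cast; ring_nf)
    (fun _ => by norm_num) (fun _ => damp_pair_le) (Finset.range r) (fun k => (k : ℝ) / r)
    (fun k hk => ⟨by positivity, by
      rw [div_lt_one hr']; exact_mod_cast Finset.mem_range.1 hk⟩) (2 * r / 2 ^ L) (by
    intro i
    have hsub : (Finset.range r).filter (fun k : ℕ => ⌊(2 : ℝ) ^ L * ((k : ℝ) / r)⌋₊ = i) ⊆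
        Finset.Ico ⌈(i : ℝ) * r / 2 ^ L⌉₊ ⌈((i : ℝ) + 1) * r / 2 ^ L⌉₊ := by
      intro k hk
      rw [Finset.mem_filter] at hk
      have f1 := Nat.floor_le (show 0 ≤ (2 : ℝ) ^ L * ((k : ℝ) / r) by positivity)
      have f2 := Nat.lt_floor_add_one ((2 : ℝ) ^ L * ((k : ℝ) / r))
      rw [hk.2] at f1 f2
      rw [← mul_div_assoc, le_div_iff₀ hr'] at f1
      rw [← mul_div_assoc, div_lt_iff₀ hr'] at f2
      rw [Finset.mem_Ico, Nat.ceil_le, Nat.lt_ceil, div_le_iff₀ h2, lt_div_iff₀ h2]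
      constructor <;> linarith
    have hc := Finset.card_le_card hsub
    rw [Nat.card_Ico] at hc
    -- A dyadic interval holds at most r/2^L + 1 of the fractions, and 1 ≤ r/2^L in this regime.
    have hc' : ((⌈((i : ℝ) + 1) * r / 2 ^ L⌉₊ - ⌈(i : ℝ) * r / 2 ^ L⌉₊ : ℕ) : ℝ) ≤
        2 * r / 2 ^ L := by
      have hle : ⌈(i : ℝ) * r / 2 ^ L⌉₊ ≤ ⌈((i : ℝ) + 1) * r / 2 ^ L⌉₊ := by
        gcongr; linarith
      rw [Nat.cast_sub hle]
      have g1 := Nat.le_ceil ((i : ℝ) * r / 2 ^ L)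
      have g2 := Nat.ceil_lt_add_one (show 0 ≤ ((i : ℝ) + 1) * r / 2 ^ L by positivity)
      have g3 : 1 ≤ r / (2 : ℝ) ^ L := by rwa [one_le_div h2]
      have g4 : ((i : ℝ) + 1) * r / 2 ^ L = (i : ℝ) * r / 2 ^ L + r / 2 ^ L := by ring
      have g5 : 2 * r / (2 : ℝ) ^ L = r / 2 ^ L + r / 2 ^ L := by ring
      linarith
    exact le_trans (by exact_mod_cast hc) hc')
  simp only [Finset.prod_const, Finset.card_range] at this
  calc _ = ∑ x ∈ Finset.range r, ∏ j ∈ Finset.range L, damp (3 * (2 ^ j * ((x : ℝ) / r))) := by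
        simp only [dampProd, zero_add, mul_comm]
    _ ≤ _ := this
    _ = _ := by
        have : (19 / 10 : ℝ) ^ L = (19 / 20) ^ L * 2 ^ L := by
          rw [← mul_pow]; norm_num
        rw [this]
        field_simp

open Real in
theorem inv_lt_abs_sin (N r : ℕ) (hr : 0 < r) (h : ¬ r ∣ N) :
    1 / (r : ℝ) < |sin (π * ((N : ℝ) / r))| := by
  have hr' : (0 : ℝ) < r := by exact_mod_cast hr
  have hN : (N : ℝ) = r * (N / r : ℕ) + (N % r : ℕ) := by exact_mod_cast (Nat.div_add_mod N r).symm
  have h1 : 1 ≤ N % r := Nat.one_le_iff_ne_zero.2 fun h0 => h (Nat.dvd_of_mod_eq_zero h0)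
  have h2 : N % r + 1 ≤ r := Nat.mod_lt _ hr
  set ρ : ℝ := ((N % r : ℕ) : ℝ) with hρ
  have h1' : 1 ≤ ρ := by rw [hρ]; exact_mod_cast h1
  have h2' : ρ + 1 ≤ r := by rw [hρ]; exact_mod_cast h2
  have e : π * ((N : ℝ) / r) = π * (ρ / r) + (N / r : ℕ) * π := by
    rw [hN]; field_simp; ring
  rw [e, sin_add_nat_mul_pi, abs_mul, abs_pow, abs_neg, abs_one, one_pow, one_mul]
  refine lt_of_lt_of_le ?_ (le_abs_self _)
  have key : ∀ σ : ℝ, 1 ≤ σ → σ ≤ r / 2 → 1 / (r : ℝ) < sin (π * (σ / r)) := by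
    intro σ s1 s2
    have := mul_le_sin (x := π * (σ / r)) (by positivity) (by
      rw [div_eq_mul_inv π 2]
      refine mul_le_mul_of_nonneg_left ?_ pi_pos.le
      rw [div_le_iff₀ hr']; linarith)
    refine lt_of_lt_of_le ?_ this
    have e2 : 2 / π * (π * (σ / r)) = 2 * σ / r := by
      field_simp
    rw [e2]
    gcongr
    linarith
  rcases le_total ρ (r / 2) with hh | hh
  · exact key ρ h1' hh
  · have := key (r - ρ) (by linarith) (by linarith)
    rw [← sin_pi_sub]
    have e3 : π - π * (ρ / r) = π * ((r - ρ) / r) := by field_simp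
    rwa [e3]

open Real in
-- As long as sin² < 1/2, doubling the angle at least doubles sin². The starting value exceeds 1/r²
-- > 4^(-L), because r does not divide 3k·2^a; 2L doublings would bring it above 1.
theorem exists_half_le_sin_sq {r L : ℕ} (a k : ℕ) (hr : Odd r) (h3 : ¬ r ∣ 3) (hL : r < 2 ^ L)
    (hk : k.Coprime r) :
    ∃ j < 2 * L, 1 / 2 ≤ sin (π * (3 * ((k : ℝ) / r * 2 ^ (a + j)))) ^ 2 := by
  by_contra! hcon
  have hr0 : 0 < r := hr.pos
  have hr' : (0 : ℝ) < r := by exact_mod_cast hr0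
  have hgrow : ∀ j ≤ 2 * L, 2 ^ j * sin (π * (3 * ((k : ℝ) / r * 2 ^ a))) ^ 2 ≤
      sin (π * (3 * ((k : ℝ) / r * 2 ^ (a + j)))) ^ 2 := by
    intro j
    induction j with
    | zero => intro _; simp
    | succ j ih =>
      intro hj
      have i1 := ih (by omega)
      have i2 := hcon j (by omega)
      have e : π * (3 * ((k : ℝ) / r * 2 ^ (a + (j + 1)))) =
          2 * (π * (3 * ((k : ℝ) / r * 2 ^ (a + j)))) := by ring
      rw [e, sin_two_mul, pow_succ]
      set x := π * (3 * ((k : ℝ) / r * 2 ^ (a + j)))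
      have := sin_sq_add_cos_sq x
      nlinarith [sq_nonneg (sin x)]
  have h1 := (hgrow (2 * L) le_rfl).trans (sin_sq_le_one _)
  have hnd : ¬ r ∣ 3 * (k * 2 ^ a) := by
    intro h
    have hc : r.Coprime (k * 2 ^ a) :=
      Nat.Coprime.mul_right hk.symm ((Nat.coprime_two_right.2 hr).pow_right a)
    exact h3 (hc.dvd_of_dvd_mul_right h)
  have h2 := inv_lt_abs_sin _ r hr0 hnd
  have e : π * (((3 * (k * 2 ^ a) : ℕ) : ℝ) / r) = π * (3 * ((k : ℝ) / r * 2 ^ a)) := by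
    push_cast; ring
  rw [e] at h2
  have hp : 1 / (2 : ℝ) ^ L ≤ 1 / r := by
    gcongr; exact_mod_cast hL.le
  have h4 := hp.trans_lt h2
  have h5 := pow_lt_pow_left₀ h4 (by positivity) two_ne_zero
  rw [sq_abs, div_pow, one_pow, div_lt_iff₀ (by positivity), ← pow_mul, mul_comm L 2] at h5
  linarith

/-- Every block of 2L consecutive digits contains one with sin² ≥ 1/2, whose factor is at most 1 -
1/20. -/
theorem dampProd_le_of_lt_pow {r L : ℕ} (a k B : ℕ) (hr : Odd r) (h3 : ¬ r ∣ 3) (hL : r < 2 ^ L)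
    (hk : k.Coprime r) : dampProd a (2 * L * B) ((k : ℝ) / r) ≤ (19 / 20) ^ B := by
  induction B with
  | zero => simp [dampProd]
  | succ B ih =>
    rw [mul_add, mul_one, dampProd_add, pow_succ]
    refine mul_le_mul ih ?_ (dampProd_nonneg _ _ _) (by positivity)
    obtain ⟨j, hj, hs⟩ := exists_half_le_sin_sq (a + 2 * L * B) k hr h3 hL hk
    rw [dampProd, ← Finset.mul_prod_erase _ _ (Finset.mem_range.2 hj)]
    refine (mul_le_of_le_one_right (damp_nonneg _) (Finset.prod_le_one
      (fun _ _ => damp_nonneg _) fun _ _ => damp_le_one _)).trans ?_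
    unfold damp
    linarith

/-- Large denominators (r ≥ 2^L) gain on average, once per digit over L digits; small ones gain
pointwise, once per block over B blocks. -/
theorem sum_dampProd_le {r : ℕ} (a L M B : ℕ) (hr : Odd r) (h3 : ¬ r ∣ 3) (hM : L ≤ M)
    (hB : 2 * L * B ≤ M) :
    ∑ k ∈ (Finset.range r).filter (fun k => k.Coprime r), dampProd a M ((k : ℝ) / r) ≤
      r * (2 * Real.exp Real.pi * (19 / 20) ^ min L B) := by
  have hE : 1 ≤ Real.exp Real.pi := Real.one_le_exp Real.pi_pos.le
  rcases le_or_gt (2 ^ L) r with h | h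
  · calc _ ≤ ∑ k ∈ Finset.range r, dampProd a M ((k : ℝ) / r) :=
          Finset.sum_le_sum_of_subset_of_nonneg (Finset.filter_subset _ _)
            fun _ _ _ => dampProd_nonneg _ _ _
      _ ≤ ∑ k ∈ Finset.range r, dampProd a L ((k : ℝ) / r) :=
          Finset.sum_le_sum fun _ _ => dampProd_anti hM _
      _ ≤ _ := sum_dampProd_le_of_pow_le a hr h
      _ ≤ _ := by
          gcongr ?_ * (?_ * ?_)
          exact pow_le_pow_of_le_one (by norm_num) (by norm_num) (min_le_left _ _)
  · calc _ ≤ ∑ k ∈ (Finset.range r).filter (fun k => k.Coprime r), (19 / 20 : ℝ) ^ B :=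
          Finset.sum_le_sum fun k hk => (dampProd_anti hB _).trans
            (dampProd_le_of_lt_pow a k B hr h3 h (Finset.mem_filter.1 hk).2)
      _ ≤ ∑ k ∈ Finset.range r, (19 / 20 : ℝ) ^ B :=
          Finset.sum_le_sum_of_subset_of_nonneg (Finset.filter_subset _ _)
            fun _ _ _ => by positivity
      _ = r * (1 * (19 / 20) ^ B) := by simp
      _ ≤ _ := by
          gcongr ?_ * (?_ * ?_)
          · linarith
          · exact pow_le_pow_of_le_one (by norm_num) (by norm_num) (min_le_right _ _)

/-! ### The product of cosines and its bilinear estimate. -/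

open Real in
/-- The normalised modulus of the exponential sum over `n`-bit odd integers. -/
noncomputable def kern (n : ℕ) (x y : ℝ) : ℝ :=
  ∏ j ∈ Finset.Ico 1 (n - 1), |cos (π * (x * 2 ^ j + y * 2 ^ (n - 1 - j)))|

theorem kern_nonneg (n : ℕ) (x y : ℝ) : 0 ≤ kern n x y :=
  Finset.prod_nonneg fun _ _ => abs_nonneg _

theorem kern_comm (n : ℕ) (x y : ℝ) : kern n x y = kern n y x := by
  refine Finset.prod_nbij' (fun j => n - 1 - j) (fun j => n - 1 - j) ?_ ?_ ?_ ?_ ?_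
  · intro j hj; simp only [Finset.mem_Ico] at hj ⊢; omega
  · intro j hj; simp only [Finset.mem_Ico] at hj ⊢; omega
  · intro j hj; simp only [Finset.mem_Ico] at hj ⊢; omega
  · intro j hj; simp only [Finset.mem_Ico] at hj ⊢; omega
  · intro j hj
    simp only [Finset.mem_Ico] at hj
    have : n - 1 - (n - 1 - j) = j := by omega
    rw [this, add_comm]

open Real in
-- The square of M + 1 cosines contains the M overlapping pairs of neighbours, and in each pair the
-- combination 2u - v eliminates y. The square is exactly what Cauchy-Schwarz provides.
theorem prod_abs_cos_sq_le_dampProd {n a M : ℕ} (h : a + M + 2 ≤ n) (x y : ℝ) :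
    (∏ j ∈ Finset.range (M + 1), |cos (π * (x * 2 ^ (a + j) + y * 2 ^ (n - 1 - (a + j))))|) ^ 2 ≤
      dampProd a M x := by
  set c : ℕ → ℝ := fun j => |cos (π * (x * 2 ^ (a + j) + y * 2 ^ (n - 1 - (a + j))))| with hc
  have c0 : ∀ j, 0 ≤ c j := fun j => abs_nonneg _
  have c1 : ∀ j, c j ≤ 1 := fun j => abs_cos_le_one _
  have p0 : ∀ f : ℕ → ℕ, 0 ≤ ∏ j ∈ Finset.range M, c (f j) :=
    fun f => Finset.prod_nonneg fun _ _ => c0 _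
  calc (∏ j ∈ Finset.range (M + 1), c j) ^ 2 =
      ((∏ j ∈ Finset.range M, c (j + 1)) * (∏ j ∈ Finset.range M, c j)) * (c 0 * c M) := by
        rw [sq]
        nth_rewrite 1 [Finset.prod_range_succ']
        rw [Finset.prod_range_succ]; ring
    _ ≤ ((∏ j ∈ Finset.range M, c (j + 1)) * (∏ j ∈ Finset.range M, c j)) * 1 := by
        have := mul_le_one₀ (c1 0) (c0 M) (c1 M)
        exact mul_le_mul_of_nonneg_left this (mul_nonneg (p0 _) (p0 fun j => j))
    _ = ∏ j ∈ Finset.range M, c (j + 1) * c j := by rw [mul_one, Finset.prod_mul_distrib]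
    _ ≤ _ := by
        refine Finset.prod_le_prod (fun j _ => mul_nonneg (c0 _) (c0 _)) fun j hj => ?_
        rw [Finset.mem_range] at hj
        refine (abs_cos_mul_abs_cos_le_damp _ _).trans (le_of_eq ?_)
        congr 1
        have e : n - 1 - (a + j) = (n - 1 - (a + (j + 1))) + 1 := by omega
        rw [e, ← add_assoc a j 1]
        ring

open Real in
-- The digits between the middle window and the top m₂ are dropped, their cosines being at most 1 in
-- modulus. The reflection j ↦ n - 1 - j makes the top digits the low digits for y.
theorem kern_le {n m₁ M m₂ : ℕ} (h₁ : 1 ≤ m₁) (h : m₁ + M + m₂ + 1 ≤ n) (h₂ : 1 ≤ m₂) (x y : ℝ) :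
    kern n x y ≤ (∏ j ∈ Finset.Ico 1 m₁, |cos (π * (x * 2 ^ j + y * 2 ^ (n - 1 - j)))|) *
      ((∏ j ∈ Finset.range (M + 1), |cos (π * (x * 2 ^ (m₁ + j) + y * 2 ^ (n - 1 - (m₁ + j))))|) *
        ∏ j ∈ Finset.Ico 1 m₂, |cos (π * (y * 2 ^ j + x * 2 ^ (n - 1 - j)))|) := by
  set c : ℕ → ℝ := fun j => |cos (π * (x * 2 ^ j + y * 2 ^ (n - 1 - j)))| with hc
  have c0 : ∀ j, 0 ≤ c j := fun j => abs_nonneg _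
  have c1 : ∀ j, c j ≤ 1 := fun j => abs_cos_le_one _
  have e1 : ∏ j ∈ Finset.Ico 1 m₂, |cos (π * (y * 2 ^ j + x * 2 ^ (n - 1 - j)))| =
      ∏ j ∈ Finset.Ico (n - m₂) (n - 1), c j := by
    refine Finset.prod_nbij' (fun j => n - 1 - j) (fun j => n - 1 - j) ?_ ?_ ?_ ?_ ?_
    · intro j hj; simp only [Finset.mem_Ico] at hj ⊢; omega
    · intro j hj; simp only [Finset.mem_Ico] at hj ⊢; omega
    · intro j hj; simp only [Finset.mem_Ico] at hj ⊢; omega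
    · intro j hj; simp only [Finset.mem_Ico] at hj ⊢; omega
    · intro j hj
      simp only [Finset.mem_Ico] at hj
      have : n - 1 - (n - 1 - j) = j := by omega
      rw [hc]; dsimp only
      rw [this, add_comm]
  have e2 : ∏ j ∈ Finset.range (M + 1), c (m₁ + j) = ∏ j ∈ Finset.Ico m₁ (m₁ + (M + 1)), c j := by
    rw [Finset.prod_Ico_eq_prod_range, Nat.add_sub_cancel_left]
  have e3 : kern n x y = (∏ j ∈ Finset.Ico 1 m₁, c j) * ((∏ j ∈ Finset.Ico m₁ (m₁ + (M + 1)), c j) *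
      ((∏ j ∈ Finset.Ico (m₁ + (M + 1)) (n - m₂), c j) *
        ∏ j ∈ Finset.Ico (n - m₂) (n - 1), c j)) := by
    rw [Finset.prod_Ico_consecutive _ (by omega) (by omega),
      Finset.prod_Ico_consecutive _ (by omega) (by omega),
      Finset.prod_Ico_consecutive _ (by omega) (by omega)]
    rfl
  have p0 : ∀ s : Finset ℕ, 0 ≤ ∏ j ∈ s, c j := fun s => Finset.prod_nonneg fun _ _ => c0 _
  rw [e1, e2, e3]
  refine mul_le_mul_of_nonneg_left (mul_le_mul_of_nonneg_left ?_ (p0 _)) (p0 _)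
  exact mul_le_of_le_one_left (p0 _) (Finset.prod_le_one (fun _ _ => c0 _) fun _ _ => c1 _)

open Real in
-- Cauchy-Schwarz on the factors v·lo and u·mid·hi. With y frozen, lo² is summed over x by the large
-- sieve; with x frozen, hi² is summed over y. The majorant of mid² does not depend on y, so it
-- survives as a weight on x.
theorem bilinear_kern_sq_le {ι κ : Type*} {n m₁ M m₂ : ℕ} (h₁ : 1 ≤ m₁)
    (h : m₁ + M + m₂ + 1 ≤ n) (h₂ : 1 ≤ m₂) (X : Finset ι) (Y : Finset κ) (α : ι → ℝ) (β : κ → ℝ)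
    (hα : ∀ x ∈ X, 0 ≤ α x ∧ α x < 1) (hβ : ∀ y ∈ Y, 0 ≤ β y ∧ β y < 1)
    (hα' : ∀ x ∈ X, ∀ x' ∈ X, x ≠ x' → 1 / 2 ^ m₁ ≤ |α x - α x'|)
    (hβ' : ∀ y ∈ Y, ∀ y' ∈ Y, y ≠ y' → 1 / 2 ^ m₂ ≤ |β y - β y'|)
    (u : ι → ℝ) (v : κ → ℝ) (hu : ∀ x, 0 ≤ u x) (hv : ∀ y, 0 ≤ v y) :
    (∑ x ∈ X, ∑ y ∈ Y, u x * v y * kern n (α x) (β y)) ^ 2 ≤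
      (2 * exp π) ^ 2 * ((∑ y ∈ Y, v y ^ 2) * ∑ x ∈ X, u x ^ 2 * dampProd m₁ M (α x)) := by
  set lo : ι → κ → ℝ := fun x y =>
    ∏ j ∈ Finset.Ico 1 m₁, |cos (π * (α x * 2 ^ j + β y * 2 ^ (n - 1 - j)))| with hlo
  set mid : ι → κ → ℝ := fun x y => ∏ j ∈ Finset.range (M + 1),
    |cos (π * (α x * 2 ^ (m₁ + j) + β y * 2 ^ (n - 1 - (m₁ + j))))| with hmid
  set hi : ι → κ → ℝ := fun x y =>
    ∏ j ∈ Finset.Ico 1 m₂, |cos (π * (β y * 2 ^ j + α x * 2 ^ (n - 1 - j)))| with hhi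
  have hlo2 : ∀ y, ∑ x ∈ X, lo x y ^ 2 ≤ 2 * exp π := by
    intro y
    refine le_trans (le_of_eq ?_)
      (sum_prod_cos_sq_le m₁ h₁ (fun j => β y * 2 ^ (n - 1 - j)) X α hα hα')
    refine Finset.sum_congr rfl fun x _ => ?_
    rw [hlo]; dsimp only
    rw [← Finset.prod_pow]
    simp only [sq_abs]
  have hhi2 : ∀ x, ∑ y ∈ Y, hi x y ^ 2 ≤ 2 * exp π := by
    intro x
    refine le_trans (le_of_eq ?_)
      (sum_prod_cos_sq_le m₂ h₂ (fun j => α x * 2 ^ (n - 1 - j)) Y β hβ hβ')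
    refine Finset.sum_congr rfl fun y _ => ?_
    rw [hhi]; dsimp only
    rw [← Finset.prod_pow]
    simp only [sq_abs]
  have hkern0 : 0 ≤ ∑ x ∈ X, ∑ y ∈ Y, u x * v y * kern n (α x) (β y) :=
    Finset.sum_nonneg fun x _ => Finset.sum_nonneg fun y _ =>
      mul_nonneg (mul_nonneg (hu _) (hv _)) (kern_nonneg _ _ _)
  have s1 : ∑ x ∈ X, ∑ y ∈ Y, u x * v y * kern n (α x) (β y) ≤
      ∑ p ∈ X ×ˢ Y, (v p.2 * lo p.1 p.2) * (u p.1 * (mid p.1 p.2 * hi p.1 p.2)) := by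
    rw [Finset.sum_product]
    refine Finset.sum_le_sum fun x _ => Finset.sum_le_sum fun y _ => ?_
    calc _ ≤ u x * v y * (lo x y * (mid x y * hi x y)) :=
          mul_le_mul_of_nonneg_left (kern_le h₁ h h₂ _ _) (mul_nonneg (hu _) (hv _))
      _ = _ := by ring
  have s2 : ∑ p ∈ X ×ˢ Y, (v p.2 * lo p.1 p.2) ^ 2 ≤ 2 * exp π * ∑ y ∈ Y, v y ^ 2 := by
    rw [Finset.sum_product_right, Finset.mul_sum]
    refine Finset.sum_le_sum fun y _ => ?_
    simp only [mul_pow]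
    rw [← Finset.mul_sum, mul_comm]
    exact mul_le_mul_of_nonneg_right (hlo2 y) (sq_nonneg _)
  have s3 : ∑ p ∈ X ×ˢ Y, (u p.1 * (mid p.1 p.2 * hi p.1 p.2)) ^ 2 ≤
      2 * exp π * ∑ x ∈ X, u x ^ 2 * dampProd m₁ M (α x) := by
    rw [Finset.sum_product, Finset.mul_sum]
    refine Finset.sum_le_sum fun x _ => ?_
    calc _ ≤ ∑ y ∈ Y, u x ^ 2 * dampProd m₁ M (α x) * hi x y ^ 2 := by
          refine Finset.sum_le_sum fun y _ => ?_
          have := prod_abs_cos_sq_le_dampProd (show m₁ + M + 2 ≤ n by omega) (α x) (β y)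
          rw [mul_pow, mul_pow, ← mul_assoc]
          gcongr
      _ = (u x ^ 2 * dampProd m₁ M (α x)) * ∑ y ∈ Y, hi x y ^ 2 := by rw [Finset.mul_sum]
      _ ≤ (u x ^ 2 * dampProd m₁ M (α x)) * (2 * exp π) :=
          mul_le_mul_of_nonneg_left (hhi2 x) (mul_nonneg (sq_nonneg _) (dampProd_nonneg _ _ _))
      _ = _ := mul_comm _ _
  calc _ ≤ _ := pow_le_pow_left₀ hkern0 s1 2
    _ ≤ _ := Finset.sum_mul_sq_le_sq_mul_sq _ _ _
    _ ≤ _ := mul_le_mul s2 s3 (Finset.sum_nonneg fun _ _ => sq_nonneg _) (by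
        have : 0 ≤ ∑ y ∈ Y, v y ^ 2 := Finset.sum_nonneg fun _ _ => sq_nonneg _
        positivity)
    _ = _ := by ring

/-! ### Reduced fractions with denominators in a dyadic block. -/

/-- The numerators of the reduced fractions in `[0, 1)` of denominator `r`. -/
def numerators (r : ℕ) : Finset ℕ := (Finset.range r).filter fun k => k.Coprime r

/-- The sum of `kern` over the pairs of reduced fractions with denominators `r₁`, `r₂`. -/
noncomputable def kernSum (n r₁ r₂ : ℕ) : ℝ :=
  ∑ k₁ ∈ numerators r₁, ∑ k₂ ∈ numerators r₂, kern n ((k₁ : ℝ) / r₁) ((k₂ : ℝ) / r₂)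

theorem kernSum_nonneg (n r₁ r₂ : ℕ) : 0 ≤ kernSum n r₁ r₂ :=
  Finset.sum_nonneg fun _ _ => Finset.sum_nonneg fun _ _ => kern_nonneg _ _ _

theorem kernSum_comm (n r₁ r₂ : ℕ) : kernSum n r₁ r₂ = kernSum n r₂ r₁ := by
  unfold kernSum
  rw [Finset.sum_comm]
  simp only [kern_comm n ((_ : ℝ) / (r₁ : ℝ))]

/-- The common factor g enters only once: the difference is a nonzero integer over g s s', not over
g² s s'. -/
theorem reduced_fractions_separated {g i m s k s' k' : ℕ} (hg : 0 < g)
    (hm : g * 4 ^ (i + 1) ≤ 2 ^ m) (hs0 : 0 < s) (hs0' : 0 < s') (hs : s < 2 ^ (i + 1))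
    (hs' : s' < 2 ^ (i + 1)) (hk : k.Coprime (g * s)) (hk' : k'.Coprime (g * s'))
    (hne : ¬ (s = s' ∧ k = k')) :
    1 / (2 : ℝ) ^ m ≤ |(k : ℝ) / (g * s : ℕ) - (k' : ℝ) / (g * s' : ℕ)| := by
  have hneq : (k * s' : ℤ) - k' * s ≠ 0 := by
    intro h0
    have h1 : k * s' = k' * s := by zify; linarith
    have h2 : s ∣ s' := (Nat.Coprime.coprime_mul_left_right hk).symm.dvd_of_dvd_mul_left
      ⟨k', by rw [h1, mul_comm]⟩
    have h3 : s' ∣ s := (Nat.Coprime.coprime_mul_left_right hk').symm.dvd_of_dvd_mul_left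
      ⟨k, by rw [← h1, mul_comm]⟩
    have h4 := Nat.dvd_antisymm h2 h3
    subst h4
    exact hne ⟨rfl, Nat.eq_of_mul_eq_mul_right hs0 h1⟩
  have h1 : (1 : ℝ) ≤ |(k : ℝ) * s' - k' * s| := by
    have := Int.one_le_abs hneq
    exact_mod_cast this
  have hg' : (0 : ℝ) < g := by exact_mod_cast hg
  have hs1 : (0 : ℝ) < s := by exact_mod_cast hs0
  have hs1' : (0 : ℝ) < s' := by exact_mod_cast hs0'
  have e : (k : ℝ) / (g * s : ℕ) - (k' : ℝ) / (g * s' : ℕ) =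
      ((k : ℝ) * s' - k' * s) / (g * s * s') := by
    push_cast; field_simp
  rw [e, abs_div, abs_of_pos (show (0 : ℝ) < g * s * s' by positivity)]
  have hle : (g : ℝ) * s * s' ≤ 2 ^ m := by
    have : g * s * s' ≤ g * 4 ^ (i + 1) := by
      have : (4 : ℕ) ^ (i + 1) = 2 ^ (i + 1) * 2 ^ (i + 1) := by rw [← mul_pow]; norm_num
      rw [this, mul_assoc]
      gcongr
    exact_mod_cast this.trans hm
  gcongr

/-- The odd integers of binary length `i + 1`. -/
def oddDyadic (i : ℕ) : Finset ℕ := (Finset.Ico (2 ^ i) (2 ^ (i + 1))).filter Odd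

open Real in
-- A denominator g s has at most g s numerators, so the squared weights w(s)²/s² sum to at most g V.
-- Damping improves this on the x side only, hence the square root of the gain.
theorem sum_dyadic_kernSum_le {n m₁ M m₂ L B g i₁ i₂ : ℕ} (hg : Odd g)
    (hm₁ : g * 4 ^ (i₁ + 1) ≤ 2 ^ m₁) (hm₂ : g * 4 ^ (i₂ + 1) ≤ 2 ^ m₂)
    (h : m₁ + M + m₂ + 1 ≤ n) (hM : L ≤ M) (hB : 2 * L * B ≤ M) (w : ℕ → ℝ) (hw : ∀ s, 0 ≤ w s)
    (V : ℝ) (hV₁ : ∑ s ∈ oddDyadic i₁, w s ^ 2 / s ≤ V)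
    (hV₂ : ∑ s ∈ oddDyadic i₂, w s ^ 2 / s ≤ V) :
    ∑ s₁ ∈ (oddDyadic i₁).filter (fun s => ¬ g * s ∣ 3), ∑ s₂ ∈ oddDyadic i₂,
        w s₁ / s₁ * (w s₂ / s₂) * kernSum n (g * s₁) (g * s₂) ≤
      g * (2 * exp π * V * √(2 * exp π * (19 / 20) ^ min L B)) := by
  set X : Finset (Σ _ : ℕ, ℕ) :=
    ((oddDyadic i₁).filter (fun s => ¬ g * s ∣ 3)).sigma fun s => numerators (g * s) with hX
  set Y : Finset (Σ _ : ℕ, ℕ) := (oddDyadic i₂).sigma fun s => numerators (g * s) with hY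
  set fr : (Σ _ : ℕ, ℕ) → ℝ := fun p => (p.2 : ℝ) / (g * p.1 : ℕ) with hfr
  set u : (Σ _ : ℕ, ℕ) → ℝ := fun p => w p.1 / p.1 with hu
  have pos_of_le : ∀ i m : ℕ, g * 4 ^ (i + 1) ≤ 2 ^ m → 1 ≤ m := by
    intro i m him
    by_contra h0
    have : m = 0 := by omega
    subst this
    have h4 : 4 ≤ 4 ^ (i + 1) := Nat.le_self_pow (by omega) 4
    have := hg.pos
    nlinarith
  have fr_mem : ∀ s k : ℕ, k ∈ numerators (g * s) →
      0 ≤ (k : ℝ) / (g * s : ℕ) ∧ (k : ℝ) / (g * s : ℕ) < 1 := by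
    intro s k hk
    have hk' := Finset.mem_range.1 (Finset.mem_filter.1 hk).1
    refine ⟨by positivity, ?_⟩
    have : (0 : ℝ) < (g * s : ℕ) := by exact_mod_cast Nat.zero_lt_of_lt hk'
    rw [div_lt_one this]
    exact_mod_cast hk'
  have dy : ∀ {i s : ℕ}, s ∈ oddDyadic i → 0 < s ∧ s < 2 ^ (i + 1) ∧ Odd s := by
    intro i s hs
    simp only [oddDyadic, Finset.mem_filter, Finset.mem_Ico] at hs
    exact ⟨hs.2.pos, hs.1.2, hs.2⟩
  have u0 : ∀ p, 0 ≤ u p := fun p => div_nonneg (hw _) (Nat.cast_nonneg _)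
  have sep : ∀ {i m : ℕ}, g * 4 ^ (i + 1) ≤ 2 ^ m → ∀ p q : (Σ _ : ℕ, ℕ), p.1 ∈ oddDyadic i →
      q.1 ∈ oddDyadic i → p.2 ∈ numerators (g * p.1) → q.2 ∈ numerators (g * q.1) → p ≠ q →
      1 / (2 : ℝ) ^ m ≤ |fr p - fr q| := by
    intro i m him p q h1 h2 h3 h4 hne
    refine reduced_fractions_separated hg.pos him (dy h1).1 (dy h2).1 (dy h1).2.1 (dy h2).2.1
      (Finset.mem_filter.1 h3).2 (Finset.mem_filter.1 h4).2 ?_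
    rintro ⟨e1, e2⟩
    exact hne (by cases p; cases q; simp_all)
  have key := bilinear_kern_sq_le (pos_of_le _ _ hm₁) h (pos_of_le _ _ hm₂) X Y fr fr
    (fun p hp => fr_mem _ _ (Finset.mem_sigma.1 hp).2)
    (fun p hp => fr_mem _ _ (Finset.mem_sigma.1 hp).2)
    (fun p hp q hq => sep hm₁ p q (Finset.mem_filter.1 (Finset.mem_sigma.1 hp).1).1
      (Finset.mem_filter.1 (Finset.mem_sigma.1 hq).1).1 (Finset.mem_sigma.1 hp).2
      (Finset.mem_sigma.1 hq).2)
    (fun p hp q hq => sep hm₂ p q (Finset.mem_sigma.1 hp).1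
      (Finset.mem_sigma.1 hq).1 (Finset.mem_sigma.1 hp).2 (Finset.mem_sigma.1 hq).2)
    u u u0 u0
  have hsum : ∑ x ∈ X, ∑ y ∈ Y, u x * u y * kern n (fr x) (fr y) =
      ∑ s₁ ∈ (oddDyadic i₁).filter (fun s => ¬ g * s ∣ 3), ∑ s₂ ∈ oddDyadic i₂,
        w s₁ / s₁ * (w s₂ / s₂) * kernSum n (g * s₁) (g * s₂) := by
    simp only [hX, hY, Finset.sum_sigma, kernSum, Finset.mul_sum]
    refine Finset.sum_congr rfl fun s _ => ?_
    rw [Finset.sum_comm]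
  set gain : ℝ := 2 * exp π * (19 / 20) ^ min L B with hgain
  have hgain0 : 0 ≤ gain := by positivity
  have hg0 : (0 : ℝ) ≤ g := Nat.cast_nonneg _
  have hV0 : 0 ≤ V := le_trans (Finset.sum_nonneg fun s _ => by have := hw s; positivity) hV₁
  have b1 : ∑ y ∈ Y, u y ^ 2 ≤ g * V := by
    rw [hY, Finset.sum_sigma]
    refine le_trans ?_ (mul_le_mul_of_nonneg_left hV₂ hg0)
    rw [Finset.mul_sum]
    refine Finset.sum_le_sum fun s hs => ?_
    have hs0 : (0 : ℝ) < s := by exact_mod_cast (dy hs).1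
    simp only [hu, Finset.sum_const, nsmul_eq_mul]
    have hc : ((numerators (g * s)).card : ℝ) ≤ g * s := by
      have := Finset.card_filter_le (Finset.range (g * s)) fun k => k.Coprime (g * s)
      rw [Finset.card_range] at this
      exact_mod_cast this
    calc _ ≤ (g * s : ℝ) * (w s / s) ^ 2 := by gcongr
      _ = _ := by field_simp
  have b2 : ∑ x ∈ X, u x ^ 2 * dampProd m₁ M (fr x) ≤ g * V * gain := by
    rw [hX, Finset.sum_sigma]
    calc _ ≤ ∑ s ∈ (oddDyadic i₁).filter (fun s => ¬ g * s ∣ 3), g * gain * (w s ^ 2 / s) := by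
          refine Finset.sum_le_sum fun s hs => ?_
          rw [Finset.mem_filter] at hs
          have hs0 : (0 : ℝ) < s := by exact_mod_cast (dy hs.1).1
          simp only [hu, hfr]
          rw [← Finset.mul_sum]
          have := sum_dampProd_le m₁ L M B (hg.mul (dy hs.1).2.2) hs.2 hM hB
          calc _ ≤ (w s / s) ^ 2 * ((g * s : ℕ) * gain) :=
                mul_le_mul_of_nonneg_left this (sq_nonneg _)
            _ = _ := by push_cast; field_simp
      _ ≤ ∑ s ∈ oddDyadic i₁, g * gain * (w s ^ 2 / s) :=
          Finset.sum_le_sum_of_subset_of_nonneg (Finset.filter_subset _ _)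
            fun s _ _ => by have := hw s; positivity
      _ = g * gain * ∑ s ∈ oddDyadic i₁, w s ^ 2 / s := by rw [Finset.mul_sum]
      _ ≤ g * gain * V := by gcongr
      _ = _ := by ring
  rw [hsum] at key
  refine abs_le_of_sq_le_sq' ?_ (by positivity) |>.2
  refine key.trans ?_
  calc _ ≤ (2 * exp π) ^ 2 * ((g * V) * (g * V * gain)) := by
        gcongr
        exact Finset.sum_nonneg fun x _ => mul_nonneg (sq_nonneg _) (dampProd_nonneg _ _ _)
    _ = _ := by rw [mul_pow, mul_pow, mul_pow, Real.sq_sqrt hgain0]; ring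

/-! ### Averages of K^ω(t)/t. -/

/-- `K ^ ω(t)`. -/
def omegaPow (K t : ℕ) : ℕ := K ^ t.primeFactors.card

/-- The sum of `K ^ ω(t) / t` over `1 ≤ t < 2 ^ n`. -/
noncomputable def omegaSum (n K : ℕ) : ℝ := ∑ t ∈ Finset.Ico 1 (2 ^ n), (omegaPow K t : ℝ) / t

theorem omegaSum_nonneg (n K : ℕ) : 0 ≤ omegaSum n K :=
  Finset.sum_nonneg fun _ _ => by positivity

theorem sum_sum_divisorsAntidiagonal_le (N : ℕ) (G : ℕ × ℕ → ℝ) (hG : ∀ p, 0 ≤ G p) :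
    ∑ t ∈ Finset.Ico 1 N, ∑ p ∈ t.divisorsAntidiagonal, G p ≤
      ∑ p ∈ Finset.Ico 1 N ×ˢ Finset.Ico 1 N, G p := by
  rw [Finset.sum_sigma']
  have hinj : Set.InjOn (fun x : (Σ _ : ℕ, ℕ × ℕ) => x.2)
      ((Finset.Ico 1 N).sigma fun t => t.divisorsAntidiagonal : Set (Σ _ : ℕ, ℕ × ℕ)) := by
    rintro ⟨t, p⟩ hx ⟨t', p'⟩ hy hxy
    simp only [Finset.coe_sigma, Set.mem_sigma_iff, Finset.mem_coe,
      Nat.mem_divisorsAntidiagonal] at hx hy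
    obtain rfl : p = p' := hxy
    have : t = t' := hx.2.1.symm.trans hy.2.1
    subst this; rfl
  rw [← Finset.sum_image (f := G) (g := fun x : (Σ _ : ℕ, ℕ × ℕ) => x.2)
    (by exact_mod_cast hinj)]
  refine Finset.sum_le_sum_of_subset_of_nonneg ?_ fun _ _ _ => hG _
  intro p hp
  obtain ⟨⟨t, p'⟩, hx, rfl⟩ := Finset.mem_image.1 hp
  simp only [Finset.mem_sigma, Finset.mem_Ico, Nat.mem_divisorsAntidiagonal] at hx
  obtain ⟨⟨h1, h2⟩, h3, h4⟩ := hx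
  simp only [Finset.mem_product, Finset.mem_Ico]
  have a1 : p'.1 ∣ t := ⟨_, h3.symm⟩
  have a2 : p'.2 ∣ t := ⟨p'.1, by rw [mul_comm]; exact h3.symm⟩
  have b1 := Nat.le_of_dvd h1 a1
  have b2 := Nat.le_of_dvd h1 a2
  have c1 := Nat.pos_of_dvd_of_pos a1 h1
  have c2 := Nat.pos_of_dvd_of_pos a2 h1
  omega

theorem card_primeFactors_mul_le (a b : ℕ) :
    (a * b).primeFactors.card ≤ a.primeFactors.card + b.primeFactors.card := by
  rcases eq_or_ne a 0 with rfl | ha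
  · simp
  rcases eq_or_ne b 0 with rfl | hb
  · simp
  rw [Nat.primeFactors_mul ha hb]
  exact Finset.card_union_le _ _

theorem omegaPow_mul_le {K : ℕ} (hK : 1 ≤ K) (a b : ℕ) :
    omegaPow K (a * b) ≤ omegaPow K a * omegaPow K b := by
  unfold omegaPow
  rw [← pow_add]
  exact Nat.pow_le_pow_right hK (card_primeFactors_mul_le a b)

theorem omegaPow_le_of_dvd {K a b : ℕ} (hK : 1 ≤ K) (h : a ∣ b) (hb : b ≠ 0) :
    omegaPow K a ≤ omegaPow K b :=
  Nat.pow_le_pow_right hK (Finset.card_le_card (Nat.primeFactors_mono h hb))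

theorem two_pow_card_primeFactors_le {t : ℕ} (ht : t ≠ 0) :
    2 ^ t.primeFactors.card ≤ t.divisors.card := by
  rw [Nat.card_divisors ht]
  refine Finset.pow_card_le_prod _ _ _ fun p hp => ?_
  have := (Nat.prime_of_mem_primeFactors hp).factorization_pos_of_dvd ht
    (Nat.dvd_of_mem_primeFactors hp)
  omega

/-- Doubling K costs 2^ω(t), at most the number of factorisations t = ab, and K^ω is
submultiplicative. -/
theorem omegaSum_two_mul_le (n : ℕ) {K : ℕ} (hK : 1 ≤ K) :
    omegaSum n (2 * K) ≤ omegaSum n K ^ 2 := by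
  have h := sum_sum_divisorsAntidiagonal_le (2 ^ n)
    (fun p => (omegaPow K p.1 : ℝ) / p.1 * ((omegaPow K p.2 : ℝ) / p.2)) fun p => by positivity
  rw [Finset.sum_product] at h
  simp only [← Finset.sum_mul_sum] at h
  rw [sq]
  refine le_trans (Finset.sum_le_sum fun t ht => ?_) h
  have ht0 : t ≠ 0 := by have := (Finset.mem_Ico.1 ht).1; omega
  calc (omegaPow (2 * K) t : ℝ) / t ≤ t.divisorsAntidiagonal.card * ((omegaPow K t : ℝ) / t) := by
        rw [← mul_div_assoc]
        gcongr
        rw [← Nat.map_div_right_divisors, Finset.card_map]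
        unfold omegaPow
        rw [mul_pow]
        exact_mod_cast Nat.mul_le_mul_right _ (two_pow_card_primeFactors_le ht0)
    _ = ∑ p ∈ t.divisorsAntidiagonal, (omegaPow K t : ℝ) / t := by simp
    _ ≤ _ := by
        refine Finset.sum_le_sum fun p hp => ?_
        obtain ⟨h1, _⟩ := Nat.mem_divisorsAntidiagonal.1 hp
        rw [div_mul_div_comm, ← h1]
        push_cast
        gcongr
        exact_mod_cast omegaPow_mul_le hK _ _

theorem omegaSum_one_le (n : ℕ) : omegaSum n 1 ≤ n + 1 := by
  have h1 : omegaSum n 1 ≤ (harmonic (2 ^ n) : ℝ) := by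
    rw [harmonic_eq_sum_Icc]
    push_cast
    simp only [omegaSum, omegaPow, one_pow, Nat.cast_one, one_div]
    refine Finset.sum_le_sum_of_subset_of_nonneg ?_ fun _ _ _ => by positivity
    intro x hx
    simp only [Finset.mem_Ico, Finset.mem_Icc] at hx ⊢
    omega
  have h2 := harmonic_le_one_add_log (2 ^ n)
  push_cast at h2
  rw [Real.log_pow] at h2
  have h3 := Real.log_two_lt_d9
  have h4 : (n : ℝ) * Real.log 2 ≤ n * 1 := by gcongr; linarith
  linarith

theorem omegaSum_two_pow_le (n e : ℕ) : omegaSum n (2 ^ e) ≤ (n + 1 : ℝ) ^ 2 ^ e := by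
  induction e with
  | zero => simpa using omegaSum_one_le n
  | succ e ih =>
    rw [pow_succ', pow_mul' (n + 1 : ℝ)]
    exact (omegaSum_two_mul_le n (Nat.one_le_two_pow)).trans
      (pow_le_pow_left₀ (omegaSum_nonneg _ _) ih 2)

/-! ### Averaging over all pairs of denominators. -/

theorem sum_odd_eq_sum_oddDyadic (n : ℕ) (F : ℕ → ℝ) :
    ∑ s ∈ (Finset.Ico 1 (2 ^ n)).filter Odd, F s =
      ∑ i ∈ Finset.range n, ∑ s ∈ oddDyadic i, F s := by
  induction n with
  | zero => simp
  | succ n ih =>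
    rw [Finset.sum_range_succ, ← ih]
    simp only [oddDyadic, Finset.sum_filter]
    rw [Finset.sum_Ico_consecutive _ Nat.one_le_two_pow (Nat.pow_le_pow_right two_pos n.le_succ)]

theorem sum_oddDyadic_le_omegaSum {n i : ℕ} (hi : i < n) :
    ∑ s ∈ oddDyadic i, (omegaPow 4 s : ℝ) ^ 2 / s ≤ omegaSum n 16 := by
  have : ∀ s, (omegaPow 4 s : ℝ) ^ 2 = omegaPow 16 s := by
    intro s
    unfold omegaPow
    push_cast
    rw [← pow_mul, mul_comm, pow_mul]; norm_num
  simp only [this]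
  refine Finset.sum_le_sum_of_subset_of_nonneg ?_ fun _ _ _ => by positivity
  intro s hs
  simp only [oddDyadic, Finset.mem_filter, Finset.mem_Ico] at hs ⊢
  have h1 : 2 ^ (i + 1) ≤ 2 ^ n := Nat.pow_le_pow_right two_pos hi
  have := hs.2.pos
  omega

/-- The separations require about log₂ g + 2i₁ and log₂ g + 2i₂ digits, together twice log₂(g
2^(i₁+i₂)) < ξn. This fixes the level of distribution at 1/2. -/
theorem exists_window {n M g i₁ i₂ : ℕ} {ξ : ℝ} (hM : M + 7 + 2 * (ξ * n) ≤ n) (hg : 0 < g)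
    (h : ((g * 2 ^ i₁ * 2 ^ i₂ : ℕ) : ℝ) < 2 ^ (ξ * n)) :
    ∃ m₁ m₂ : ℕ, g * 4 ^ (i₁ + 1) ≤ 2 ^ m₁ ∧ g * 4 ^ (i₂ + 1) ≤ 2 ^ m₂ ∧
      m₁ + M + m₂ + 1 ≤ n := by
  set c := Nat.clog 2 g with hc
  have h1 : g ≤ 2 ^ c := Nat.le_pow_clog one_lt_two g
  have h2 : 2 ^ c < 2 * g := by
    rcases Nat.lt_or_ge 1 g with hg1 | hg1
    · have := Nat.pow_pred_clog_lt_self one_lt_two hg1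
      have hc0 : 0 < c := Nat.clog_pos one_lt_two hg1
      obtain ⟨c', hc'⟩ : ∃ c', c = c' + 1 := ⟨c - 1, by omega⟩
      rw [← hc, hc'] at this
      rw [hc', pow_succ]
      simp only [Nat.pred_succ] at this
      omega
    · obtain rfl : g = 1 := by omega
      simp [hc]
  have h3 : (2 : ℝ) ^ ((c + i₁ + i₂ : ℕ) : ℝ) < 2 ^ (ξ * n + 1) := by
    rw [Real.rpow_natCast, Real.rpow_add two_pos, Real.rpow_one]
    calc (2 : ℝ) ^ (c + i₁ + i₂) = 2 ^ c * (2 ^ i₁ * 2 ^ i₂) := by rw [pow_add, pow_add, mul_assoc]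
      _ ≤ (2 * g) * (2 ^ i₁ * 2 ^ i₂) := by
          gcongr; exact_mod_cast h2.le
      _ = ((g * 2 ^ i₁ * 2 ^ i₂ : ℕ) : ℝ) * 2 := by push_cast; ring
      _ < _ := by gcongr
  have h4 := (Real.rpow_lt_rpow_left_iff one_lt_two).1 h3
  have key : ∀ i : ℕ, g * 4 ^ (i + 1) ≤ 2 ^ (c + 2 * i + 2) := by
    intro i
    have : (4 : ℕ) ^ (i + 1) = 2 ^ (2 * i + 2) := by
      rw [show 2 * i + 2 = 2 * (i + 1) by ring, pow_mul]; norm_num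
    rw [this, add_assoc, pow_add 2 c]
    gcongr
  refine ⟨c + 2 * i₁ + 2, c + 2 * i₂ + 2, key _, key _, ?_⟩
  -- The 7 consists of 2 from rounding log₂ g up, 2 + 2 from the two exponents, and 1 for the extra
  -- middle digit.
  have h5 : ((c + 2 * i₁ + 2 + M + (c + 2 * i₂ + 2) + 1 : ℕ) : ℝ) < ((n + 1 : ℕ) : ℝ) := by
    push_cast at h4 ⊢
    linarith
  have h6 : c + 2 * i₁ + 2 + M + (c + 2 * i₂ + 2) + 1 < n + 1 := by exact_mod_cast h5
  omega

open Real in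
-- There are n² pairs of dyadic blocks. As 2^i is the least possible size in block i, a contributing
-- pair satisfies g 2^i₁ 2^i₂ < 2^(ξn), so its window exists.
theorem sum_sum_kernSum_fixed_gcd_le {n M L B g : ℕ} {ξ : ℝ} (hM : M + 7 + 2 * (ξ * n) ≤ n)
    (hL : L ≤ M) (hB : 2 * L * B ≤ M) (hg : Odd g) :
    ∑ s₁ ∈ (Finset.Ico 1 (2 ^ n)).filter Odd, ∑ s₂ ∈ (Finset.Ico 1 (2 ^ n)).filter Odd,
      (if ((g * s₁ * s₂ : ℕ) : ℝ) < 2 ^ (ξ * n) ∧ ¬ g * s₁ ∣ 3 then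
        (omegaPow 4 s₁ : ℝ) / s₁ * ((omegaPow 4 s₂ : ℝ) / s₂) * kernSum n (g * s₁) (g * s₂)
      else 0) ≤
    n ^ 2 * (g * (2 * exp π * omegaSum n 16 * √(2 * exp π * (19 / 20) ^ min L B))) := by
  set b := g * (2 * exp π * omegaSum n 16 * √(2 * exp π * (19 / 20) ^ min L B)) with hb
  have hb0 : 0 ≤ b := by have := omegaSum_nonneg n 16; positivity
  rw [sum_odd_eq_sum_oddDyadic]
  simp only [sum_odd_eq_sum_oddDyadic]
  have hblock : ∀ i₁ ∈ Finset.range n, ∀ i₂ ∈ Finset.range n,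
      ∑ s₁ ∈ oddDyadic i₁, ∑ s₂ ∈ oddDyadic i₂,
      (if ((g * s₁ * s₂ : ℕ) : ℝ) < 2 ^ (ξ * n) ∧ ¬ g * s₁ ∣ 3 then
        (omegaPow 4 s₁ : ℝ) / s₁ * ((omegaPow 4 s₂ : ℝ) / s₂) * kernSum n (g * s₁) (g * s₂)
      else 0) ≤ b := by
    intro i₁ hi₁ i₂ hi₂
    have hnn : ∀ s₁ s₂ : ℕ, 0 ≤ (omegaPow 4 s₁ : ℝ) / s₁ * ((omegaPow 4 s₂ : ℝ) / s₂) *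
        kernSum n (g * s₁) (g * s₂) := fun s₁ s₂ =>
      mul_nonneg (by positivity) (kernSum_nonneg _ _ _)
    by_cases h : ((g * 2 ^ i₁ * 2 ^ i₂ : ℕ) : ℝ) < 2 ^ (ξ * n)
    · obtain ⟨m₁, m₂, hm₁, hm₂, hn⟩ := exists_window hM hg.pos h
      refine le_trans ?_ (sum_dyadic_kernSum_le hg hm₁ hm₂ hn hL hB (fun s => (omegaPow 4 s : ℝ))
        (fun s => Nat.cast_nonneg _) (omegaSum n 16)
        (sum_oddDyadic_le_omegaSum (Finset.mem_range.1 hi₁))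
        (sum_oddDyadic_le_omegaSum (Finset.mem_range.1 hi₂)))
      rw [Finset.sum_filter]
      refine Finset.sum_le_sum fun s₁ _ => ?_
      by_cases h3 : g * s₁ ∣ 3
      · simp [h3]
      · rw [if_pos h3]
        refine Finset.sum_le_sum fun s₂ _ => ?_
        split_ifs
        · exact le_rfl
        · exact hnn _ _
    · refine le_trans (le_of_eq ?_) hb0
      refine Finset.sum_eq_zero fun s₁ hs₁ => Finset.sum_eq_zero fun s₂ hs₂ => ?_
      rw [if_neg]
      rintro ⟨h1, _⟩
      refine h (lt_of_le_of_lt ?_ h1)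
      simp only [oddDyadic, Finset.mem_filter, Finset.mem_Ico] at hs₁ hs₂
      have a1 := hs₁.1.1
      have a2 := hs₂.1.1
      exact_mod_cast Nat.mul_le_mul (Nat.mul_le_mul_left g a1) a2
  calc _ = ∑ i₁ ∈ Finset.range n, ∑ i₂ ∈ Finset.range n, ∑ s₁ ∈ oddDyadic i₁,
        ∑ s₂ ∈ oddDyadic i₂, _ := by
        refine Finset.sum_congr rfl fun i₁ _ => ?_
        rw [Finset.sum_comm]
    _ ≤ ∑ i₁ ∈ Finset.range n, ∑ i₂ ∈ Finset.range n, b :=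
        Finset.sum_le_sum fun i₁ h1 => Finset.sum_le_sum fun i₂ h2 => hblock i₁ h1 i₂ h2
    _ = _ := by simp; ring

open Real in
-- One denominator does not divide 3, and by symmetry it may be taken first, at the cost of a factor
-- 2. The weight 4^ω(g)/g² against the factor g of the bound for fixed g leaves a sum of 4^ω(g)/g.
theorem sum_gcd_kernSum_le {n M L B : ℕ} {ξ : ℝ} (hM : M + 7 + 2 * (ξ * n) ≤ n)
    (hL : L ≤ M) (hB : 2 * L * B ≤ M) :
    ∑ g ∈ Finset.Ico 1 (2 ^ n), ∑ s₁ ∈ Finset.Ico 1 (2 ^ n), ∑ s₂ ∈ Finset.Ico 1 (2 ^ n),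
      (if Odd g ∧ Odd s₁ ∧ Odd s₂ ∧ ((g * s₁ * s₂ : ℕ) : ℝ) < 2 ^ (ξ * n) ∧
          ¬ (g * s₁ ∣ 3 ∧ g * s₂ ∣ 3) then
        (omegaPow 4 g : ℝ) / g ^ 2 * ((omegaPow 4 s₁ : ℝ) / s₁ * ((omegaPow 4 s₂ : ℝ) / s₂) *
          kernSum n (g * s₁) (g * s₂)) else 0) ≤
    omegaSum n 4 * (2 * (n ^ 2 * (2 * exp π * omegaSum n 16 *
      √(2 * exp π * (19 / 20) ^ min L B)))) := by
  set b := 2 * exp π * omegaSum n 16 * √(2 * exp π * (19 / 20) ^ min L B) with hb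
  have hb0 : 0 ≤ b := by have := omegaSum_nonneg n 16; positivity
  rw [omegaSum, Finset.sum_mul]
  refine Finset.sum_le_sum fun g hg => ?_
  have hg0 : (0 : ℝ) < g := by exact_mod_cast (Finset.mem_Ico.1 hg).1
  by_cases hodd : Odd g
  swap
  · simp only [hodd, false_and, if_false, Finset.sum_const_zero]
    positivity
  set J := (Finset.Ico 1 (2 ^ n)).filter Odd with hJ
  set A : ℕ → ℕ → ℝ := fun s₁ s₂ =>
    if ((g * s₁ * s₂ : ℕ) : ℝ) < 2 ^ (ξ * n) ∧ ¬ g * s₁ ∣ 3 then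
      (omegaPow 4 s₁ : ℝ) / s₁ * ((omegaPow 4 s₂ : ℝ) / s₂) * kernSum n (g * s₁) (g * s₂)
    else 0 with hA
  have hkey : ∑ s₁ ∈ J, ∑ s₂ ∈ J, A s₁ s₂ ≤ n ^ 2 * (g * b) :=
    sum_sum_kernSum_fixed_gcd_le hM hL hB hodd
  have hA0 : ∀ s₁ s₂, 0 ≤ A s₁ s₂ := by
    intro s₁ s₂
    simp only [hA]
    split_ifs
    · exact mul_nonneg (by positivity) (kernSum_nonneg _ _ _)
    · exact le_rfl
  have hle : ∀ s₁ s₂ : ℕ, (if Odd g ∧ Odd s₁ ∧ Odd s₂ ∧ ((g * s₁ * s₂ : ℕ) : ℝ) < 2 ^ (ξ * n) ∧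
          ¬ (g * s₁ ∣ 3 ∧ g * s₂ ∣ 3) then
        (omegaPow 4 g : ℝ) / g ^ 2 * ((omegaPow 4 s₁ : ℝ) / s₁ * ((omegaPow 4 s₂ : ℝ) / s₂) *
          kernSum n (g * s₁) (g * s₂)) else 0) ≤
      if Odd s₁ then (if Odd s₂ then (omegaPow 4 g : ℝ) / g ^ 2 * (A s₁ s₂ + A s₂ s₁) else 0)
        else 0 := by
    intro s₁ s₂
    have hpos : (0 : ℝ) ≤ (omegaPow 4 g : ℝ) / g ^ 2 := by positivity
    by_cases h : Odd g ∧ Odd s₁ ∧ Odd s₂ ∧ ((g * s₁ * s₂ : ℕ) : ℝ) < 2 ^ (ξ * n) ∧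
          ¬ (g * s₁ ∣ 3 ∧ g * s₂ ∣ 3)
    · rw [if_pos h, if_pos h.2.1, if_pos h.2.2.1]
      refine mul_le_mul_of_nonneg_left ?_ hpos
      obtain ⟨_, _, _, h1, h2⟩ := h
      by_cases h3 : g * s₁ ∣ 3
      · have h4 : ¬ g * s₂ ∣ 3 := fun h => h2 ⟨h3, h⟩
        have h5 : ((g * s₂ * s₁ : ℕ) : ℝ) < 2 ^ (ξ * n) := by rwa [mul_right_comm]
        have h6 := hA0 s₁ s₂
        have h7 : A s₂ s₁ = (omegaPow 4 s₁ : ℝ) / s₁ * ((omegaPow 4 s₂ : ℝ) / s₂) *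
            kernSum n (g * s₁) (g * s₂) := by
          simp only [hA]
          rw [if_pos ⟨h5, h4⟩, kernSum_comm]; ring
        linarith
      · have h6 := hA0 s₂ s₁
        have h7 : A s₁ s₂ = (omegaPow 4 s₁ : ℝ) / s₁ * ((omegaPow 4 s₂ : ℝ) / s₂) *
            kernSum n (g * s₁) (g * s₂) := by
          simp only [hA]
          rw [if_pos ⟨h1, h3⟩]
        linarith
    · rw [if_neg h]
      split_ifs
      · exact mul_nonneg hpos (add_nonneg (hA0 _ _) (hA0 _ _))
      all_goals exact le_rfl
  have hcond : ∀ s₁ : ℕ, ∑ s₂ ∈ Finset.Ico 1 (2 ^ n), (if Odd s₁ then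
      (if Odd s₂ then (omegaPow 4 g : ℝ) / g ^ 2 * (A s₁ s₂ + A s₂ s₁) else 0) else 0) =
      if Odd s₁ then ∑ s₂ ∈ J, (omegaPow 4 g : ℝ) / g ^ 2 * (A s₁ s₂ + A s₂ s₁) else 0 := by
    intro s₁
    by_cases h : Odd s₁
    · simp only [h, if_true, hJ, Finset.sum_filter]
    · simp only [h, if_false, Finset.sum_const_zero]
  calc _ ≤ ∑ s₁ ∈ Finset.Ico 1 (2 ^ n), ∑ s₂ ∈ Finset.Ico 1 (2 ^ n), (if Odd s₁ then
      (if Odd s₂ then (omegaPow 4 g : ℝ) / g ^ 2 * (A s₁ s₂ + A s₂ s₁) else 0) else 0) :=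
        Finset.sum_le_sum fun s₁ _ => Finset.sum_le_sum fun s₂ _ => hle s₁ s₂
    _ = ∑ s₁ ∈ J, ∑ s₂ ∈ J, (omegaPow 4 g : ℝ) / g ^ 2 * (A s₁ s₂ + A s₂ s₁) := by
        simp only [hcond]
        rw [hJ, Finset.sum_filter]
    _ = (omegaPow 4 g : ℝ) / g ^ 2 * (∑ s₁ ∈ J, ∑ s₂ ∈ J, A s₁ s₂ +
        ∑ s₁ ∈ J, ∑ s₂ ∈ J, A s₁ s₂) := by
        simp only [← Finset.mul_sum, Finset.sum_add_distrib]
        congr 2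
        exact Finset.sum_comm
    _ ≤ (omegaPow 4 g : ℝ) / g ^ 2 * (n ^ 2 * (g * b) + n ^ 2 * (g * b)) := by gcongr
    _ = _ := by field_simp; ring

open Real in
theorem sum_lcm_kernSum_le {n M L B : ℕ} {ξ : ℝ} (hM : M + 7 + 2 * (ξ * n) ≤ n)
    (hL : L ≤ M) (hB : 2 * L * B ≤ M) :
    ∑ r₁ ∈ Finset.Ico 1 (2 ^ n), ∑ r₂ ∈ Finset.Ico 1 (2 ^ n),
      (if Odd r₁ ∧ Odd r₂ ∧ ((r₁.lcm r₂ : ℕ) : ℝ) < 2 ^ (ξ * n) ∧ ¬ (r₁ ∣ 3 ∧ r₂ ∣ 3) then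
        (omegaPow 4 (r₁.lcm r₂) : ℝ) / (r₁ * r₂) * kernSum n r₁ r₂ else 0) ≤
    omegaSum n 4 * (2 * (n ^ 2 * (2 * exp π * omegaSum n 16 *
      √(2 * exp π * (19 / 20) ^ min L B)))) := by
  refine le_trans ?_ (sum_gcd_kernSum_le hM hL hB)
  set I := Finset.Ico 1 (2 ^ n) with hI
  set H : ℕ × ℕ × ℕ → ℝ := fun p =>
    if Odd p.1 ∧ Odd p.2.1 ∧ Odd p.2.2 ∧ ((p.1 * p.2.1 * p.2.2 : ℕ) : ℝ) < 2 ^ (ξ * n) ∧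
          ¬ (p.1 * p.2.1 ∣ 3 ∧ p.1 * p.2.2 ∣ 3) then
        (omegaPow 4 p.1 : ℝ) / p.1 ^ 2 * ((omegaPow 4 p.2.1 : ℝ) / p.2.1 *
          ((omegaPow 4 p.2.2 : ℝ) / p.2.2) * kernSum n (p.1 * p.2.1) (p.1 * p.2.2)) else 0 with hH
  have hH0 : ∀ p, 0 ≤ H p := by
    intro p
    simp only [hH]
    split_ifs
    · exact mul_nonneg (by positivity) (mul_nonneg (by positivity) (kernSum_nonneg _ _ _))
    · exact le_rfl
  set τ : ℕ × ℕ → ℕ × ℕ × ℕ := fun p =>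
    (p.1.gcd p.2, p.1 / p.1.gcd p.2, p.2 / p.1.gcd p.2) with hτ
  have hback : ∀ p : ℕ × ℕ, (τ p).1 * (τ p).2.1 = p.1 ∧ (τ p).1 * (τ p).2.2 = p.2 := fun p =>
    ⟨Nat.mul_div_cancel' (Nat.gcd_dvd_left _ _), Nat.mul_div_cancel' (Nat.gcd_dvd_right _ _)⟩
  have hinj : Function.Injective τ := by
    intro p q h
    have h1 := hback p
    have h2 := hback q
    rw [h] at h1
    exact Prod.ext (h1.1.symm.trans h2.1) (h1.2.symm.trans h2.2)
  have hR : ∑ g ∈ I, ∑ s₁ ∈ I, ∑ s₂ ∈ I, H (g, s₁, s₂) = ∑ p ∈ I ×ˢ I ×ˢ I, H p := by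
    simp only [Finset.sum_product]
  refine le_trans ?_ (le_of_eq hR.symm)
  have himg : ∑ p ∈ I ×ˢ I, H (τ p) ≤ ∑ p ∈ I ×ˢ I ×ˢ I, H p := by
    rw [← Finset.sum_image (f := H) (g := τ) hinj.injOn]
    refine Finset.sum_le_sum_of_subset_of_nonneg ?_ fun _ _ _ => hH0 _
    intro q hq
    obtain ⟨p, hp, rfl⟩ := Finset.mem_image.1 hq
    simp only [Finset.mem_product, hI, Finset.mem_Ico, hτ] at hp ⊢
    have g1 := Nat.gcd_le_left p.2 hp.1.1
    have g0 := Nat.gcd_pos_of_pos_left p.2 hp.1.1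
    have a1 := Nat.div_le_self p.1 (p.1.gcd p.2)
    have a2 := Nat.div_le_self p.2 (p.1.gcd p.2)
    have b1 := Nat.div_pos g1 g0
    have b2 := Nat.div_pos (Nat.gcd_le_right p.1 hp.2.1) g0
    omega
  refine le_trans ?_ himg
  rw [Finset.sum_product]
  refine Finset.sum_le_sum fun r₁ h₁ => Finset.sum_le_sum fun r₂ h₂ => ?_
  split_ifs with h
  swap
  · exact hH0 _
  obtain ⟨o1, o2, hD, h3⟩ := h
  have hb := hback (r₁, r₂)
  have hgd : (τ (r₁, r₂)).1 = r₁.gcd r₂ := rfl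
  set g := (τ (r₁, r₂)).1
  set s₁ := (τ (r₁, r₂)).2.1
  set s₂ := (τ (r₁, r₂)).2.2
  have e1 : g * s₁ = r₁ := hb.1
  have e2 : g * s₂ = r₂ := hb.2
  have hr₁ : 0 < r₁ := o1.pos
  have hr₂ : 0 < r₂ := o2.pos
  have hg0 : 0 < g := by rw [hgd]; exact Nat.gcd_pos_of_pos_left _ hr₁
  have hlcm : r₁.lcm r₂ = g * s₁ * s₂ := by
    refine Nat.eq_of_mul_eq_mul_left hg0 ?_
    rw [hgd, Nat.gcd_mul_lcm, ← hgd, ← e1, ← e2]; ring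
  rw [← e1] at o1
  rw [← e2] at o2
  have og := Nat.odd_mul.1 o1
  have og2 := Nat.odd_mul.1 o2
  have hc : Odd g ∧ Odd s₁ ∧ Odd s₂ ∧ ((g * s₁ * s₂ : ℕ) : ℝ) < 2 ^ (ξ * n) ∧
          ¬ (g * s₁ ∣ 3 ∧ g * s₂ ∣ 3) := by
    refine ⟨og.1, og.2, og2.2, ?_, ?_⟩
    · rw [← hlcm]; exact hD
    · rw [e1, e2]; exact h3
  have hHval : H (τ (r₁, r₂)) = (omegaPow 4 g : ℝ) / g ^ 2 * ((omegaPow 4 s₁ : ℝ) / s₁ *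
          ((omegaPow 4 s₂ : ℝ) / s₂) * kernSum n (g * s₁) (g * s₂)) := if_pos hc
  rw [hHval, e1, e2, ← mul_assoc]
  refine mul_le_mul_of_nonneg_right ?_ (kernSum_nonneg _ _ _)
  have hw : omegaPow 4 (r₁.lcm r₂) ≤ omegaPow 4 g * omegaPow 4 s₁ * omegaPow 4 s₂ := by
    rw [hlcm]
    exact (omegaPow_mul_le (by norm_num) _ _).trans
      (Nat.mul_le_mul_right _ (omegaPow_mul_le (by norm_num) _ _))
  have hw' : (omegaPow 4 (r₁.lcm r₂) : ℝ) ≤ omegaPow 4 g * omegaPow 4 s₁ * omegaPow 4 s₂ := by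
    exact_mod_cast hw
  have hrr : (r₁ : ℝ) * r₂ = g ^ 2 * s₁ * s₂ := by
    rw [← e1, ← e2]; push_cast; ring
  rw [hrr]
  calc _ ≤ ((omegaPow 4 g : ℝ) * omegaPow 4 s₁ * omegaPow 4 s₂) / (g ^ 2 * s₁ * s₂) := by gcongr
    _ = _ := by
        have : (0 : ℝ) < s₁ := by exact_mod_cast og.2.pos
        have : (0 : ℝ) < s₂ := by exact_mod_cast og2.2.pos
        have : (0 : ℝ) < g := by exact_mod_cast hg0
        field_simp

/-- The contribution of the frequencies that are not multiples of `1 / 3`. -/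
noncomputable def divisorKernSum (n q₁ q₂ : ℕ) : ℝ :=
  ∑ r₁ ∈ q₁.divisors, ∑ r₂ ∈ q₂.divisors, if r₁ ∣ 3 ∧ r₂ ∣ 3 then 0 else kernSum n r₁ r₂

theorem divisorKernSum_nonneg (n q₁ q₂ : ℕ) : 0 ≤ divisorKernSum n q₁ q₂ :=
  Finset.sum_nonneg fun _ _ => Finset.sum_nonneg fun _ _ => by
    split_ifs
    · exact le_rfl
    · exact kernSum_nonneg _ _ _

open Real in
-- With qᵢ = rᵢ tᵢ, lcm(q₁, q₂) divides lcm(r₁, r₂) t₁ t₂, so the cofactors separate and cost two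
-- factors `omegaSum n 4`.
theorem sum_divisorKernSum_le {n M L B : ℕ} {ξ : ℝ} (hM : M + 7 + 2 * (ξ * n) ≤ n)
    (hL : L ≤ M) (hB : 2 * L * B ≤ M) :
    ∑ q₁ ∈ Finset.Ico 1 (2 ^ n), ∑ q₂ ∈ Finset.Ico 1 (2 ^ n),
      (if Odd q₁ ∧ Odd q₂ ∧ ((q₁.lcm q₂ : ℕ) : ℝ) < 2 ^ (ξ * n) then
        (omegaPow 4 (q₁.lcm q₂) : ℝ) / (q₁ * q₂) * divisorKernSum n q₁ q₂ else 0) ≤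
    4 * exp π * √(2 * exp π) * (n + 1) ^ 30 * √((19 / 20) ^ min L B) := by
  set I := Finset.Ico 1 (2 ^ n) with hI
  set K : ℕ → ℕ → ℝ := fun r₁ r₂ =>
    if Odd r₁ ∧ Odd r₂ ∧ ((r₁.lcm r₂ : ℕ) : ℝ) < 2 ^ (ξ * n) ∧ ¬ (r₁ ∣ 3 ∧ r₂ ∣ 3) then
        (omegaPow 4 (r₁.lcm r₂) : ℝ) / (r₁ * r₂) * kernSum n r₁ r₂ else 0 with hK
  have hK0 : ∀ r₁ r₂, 0 ≤ K r₁ r₂ := by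
    intro r₁ r₂
    simp only [hK]
    split_ifs
    · exact mul_nonneg (by positivity) (kernSum_nonneg _ _ _)
    · exact le_rfl
  set c : ℕ → ℝ := fun t => (omegaPow 4 t : ℝ) / t with hc
  have hc0 : ∀ t, 0 ≤ c t := fun t => by positivity
  have hpt : ∀ q₁ ∈ I, ∀ q₂ ∈ I, (if Odd q₁ ∧ Odd q₂ ∧ ((q₁.lcm q₂ : ℕ) : ℝ) < 2 ^ (ξ * n) then
        (omegaPow 4 (q₁.lcm q₂) : ℝ) / (q₁ * q₂) * divisorKernSum n q₁ q₂ else 0) ≤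
      ∑ p₁ ∈ q₁.divisorsAntidiagonal, ∑ p₂ ∈ q₂.divisorsAntidiagonal,
        K p₁.1 p₂.1 * (c p₁.2 * c p₂.2) := by
    intro q₁ h₁ q₂ h₂
    split_ifs with h
    swap
    · exact Finset.sum_nonneg fun _ _ => Finset.sum_nonneg fun _ _ =>
        mul_nonneg (hK0 _ _) (mul_nonneg (hc0 _) (hc0 _))
    obtain ⟨o1, o2, hD⟩ := h
    rw [divisorKernSum, ← Nat.sum_divisorsAntidiagonal (fun r₁ _ => ∑ r₂ ∈ q₂.divisors,
      if r₁ ∣ 3 ∧ r₂ ∣ 3 then 0 else kernSum n r₁ r₂), Finset.mul_sum]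
    refine Finset.sum_le_sum fun p₁ hp₁ => ?_
    rw [← Nat.sum_divisorsAntidiagonal (fun r₂ _ =>
      if p₁.1 ∣ 3 ∧ r₂ ∣ 3 then 0 else kernSum n p₁.1 r₂), Finset.mul_sum]
    refine Finset.sum_le_sum fun p₂ hp₂ => ?_
    obtain ⟨r₁, t₁⟩ := p₁
    obtain ⟨r₂, t₂⟩ := p₂
    simp only [Nat.mem_divisorsAntidiagonal] at hp₁ hp₂ ⊢
    obtain ⟨rfl, _⟩ := hp₁
    obtain ⟨rfl, _⟩ := hp₂
    by_cases h3 : r₁ ∣ 3 ∧ r₂ ∣ 3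
    · rw [if_pos h3, mul_zero]
      exact mul_nonneg (hK0 _ _) (mul_nonneg (hc0 _) (hc0 _))
    rw [if_neg h3]
    have u1 := Nat.odd_mul.1 o1
    have u2 := Nat.odd_mul.1 o2
    have hpos : 0 < (r₁ * t₁).lcm (r₂ * t₂) := Nat.lcm_pos o1.pos o2.pos
    have hdvd : r₁.lcm r₂ ∣ (r₁ * t₁).lcm (r₂ * t₂) :=
      Nat.lcm_dvd ((dvd_mul_right _ _).trans (Nat.dvd_lcm_left _ _))
        ((dvd_mul_right _ _).trans (Nat.dvd_lcm_right _ _))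
    have hKv : K r₁ r₂ = (omegaPow 4 (r₁.lcm r₂) : ℝ) / (r₁ * r₂) * kernSum n r₁ r₂ := by
      refine if_pos ⟨u1.1, u2.1, lt_of_le_of_lt ?_ hD, h3⟩
      exact_mod_cast Nat.le_of_dvd hpos hdvd
    rw [hKv]
    have hw : omegaPow 4 ((r₁ * t₁).lcm (r₂ * t₂)) ≤
        omegaPow 4 (r₁.lcm r₂) * (omegaPow 4 t₁ * omegaPow 4 t₂) := by
      have hd2 : (r₁ * t₁).lcm (r₂ * t₂) ∣ r₁.lcm r₂ * (t₁ * t₂) := by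
        refine Nat.lcm_dvd ?_ ?_
        · exact mul_dvd_mul (Nat.dvd_lcm_left _ _) (dvd_mul_right _ _)
        · exact mul_dvd_mul (Nat.dvd_lcm_right _ _) (dvd_mul_left _ _)
      have hne : r₁.lcm r₂ * (t₁ * t₂) ≠ 0 :=
        (Nat.mul_pos (Nat.lcm_pos u1.1.pos u2.1.pos) (Nat.mul_pos u1.2.pos u2.2.pos)).ne'
      exact (omegaPow_le_of_dvd (by norm_num) hd2 hne).trans
        ((omegaPow_mul_le (by norm_num) _ _).trans
          (Nat.mul_le_mul_left _ (omegaPow_mul_le (by norm_num) _ _)))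
    have hw' : (omegaPow 4 ((r₁ * t₁).lcm (r₂ * t₂)) : ℝ) ≤
        omegaPow 4 (r₁.lcm r₂) * (omegaPow 4 t₁ * omegaPow 4 t₂) := by exact_mod_cast hw
    have hks := kernSum_nonneg n r₁ r₂
    have p1 : (0 : ℝ) < r₁ := by exact_mod_cast u1.1.pos
    have p2 : (0 : ℝ) < r₂ := by exact_mod_cast u2.1.pos
    have p3 : (0 : ℝ) < t₁ := by exact_mod_cast u1.2.pos
    have p4 : (0 : ℝ) < t₂ := by exact_mod_cast u2.2.pos
    calc _ ≤ (omegaPow 4 (r₁.lcm r₂) * (omegaPow 4 t₁ * omegaPow 4 t₂) : ℝ) /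
          ((r₁ * t₁ : ℕ) * (r₂ * t₂ : ℕ)) * kernSum n r₁ r₂ := by gcongr
      _ = _ := by simp only [hc]; push_cast; field_simp
  have hsum : ∑ q₁ ∈ I, ∑ q₂ ∈ I, ∑ p₁ ∈ q₁.divisorsAntidiagonal, ∑ p₂ ∈ q₂.divisorsAntidiagonal,
      K p₁.1 p₂.1 * (c p₁.2 * c p₂.2) ≤
      ∑ p₁ ∈ I ×ˢ I, ∑ p₂ ∈ I ×ˢ I, K p₁.1 p₂.1 * (c p₁.2 * c p₂.2) := by
    have hterm0 : ∀ p₁ p₂ : ℕ × ℕ, 0 ≤ K p₁.1 p₂.1 * (c p₁.2 * c p₂.2) := fun p₁ p₂ =>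
        mul_nonneg (hK0 _ _) (mul_nonneg (hc0 _) (hc0 _))
    calc _ = ∑ q₁ ∈ I, ∑ p₁ ∈ q₁.divisorsAntidiagonal, ∑ q₂ ∈ I, ∑ p₂ ∈ q₂.divisorsAntidiagonal,
          K p₁.1 p₂.1 * (c p₁.2 * c p₂.2) :=
          Finset.sum_congr rfl fun q₁ _ => Finset.sum_comm
      _ ≤ _ := sum_sum_divisorsAntidiagonal_le (2 ^ n) (fun p₁ => ∑ q₂ ∈ I,
          ∑ p₂ ∈ q₂.divisorsAntidiagonal, K p₁.1 p₂.1 * (c p₁.2 * c p₂.2)) fun p₁ =>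
            Finset.sum_nonneg fun _ _ => Finset.sum_nonneg fun _ _ => hterm0 _ _
      _ ≤ _ := Finset.sum_le_sum fun p₁ _ =>
          sum_sum_divisorsAntidiagonal_le (2 ^ n) _ fun p₂ => hterm0 _ _
  have hfac : ∑ p₁ ∈ I ×ˢ I, ∑ p₂ ∈ I ×ˢ I, K p₁.1 p₂.1 * (c p₁.2 * c p₂.2) =
      (∑ r₁ ∈ I, ∑ r₂ ∈ I, K r₁ r₂) * (omegaSum n 4 * omegaSum n 4) := by
    simp only [Finset.sum_product, omegaSum]
    rw [Finset.sum_mul]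
    refine Finset.sum_congr rfl fun r₁ _ => ?_
    rw [Finset.sum_mul, Finset.sum_comm]
    refine Finset.sum_congr rfl fun r₂ _ => ?_
    rw [Finset.sum_mul_sum, Finset.mul_sum]
    refine Finset.sum_congr rfl fun t₁ _ => ?_
    rw [Finset.mul_sum]
  have hW4 : omegaSum n 4 ≤ (n + 1 : ℝ) ^ 4 := omegaSum_two_pow_le n 2
  have hW16 : omegaSum n 16 ≤ (n + 1 : ℝ) ^ 16 := omegaSum_two_pow_le n 4
  have h40 := omegaSum_nonneg n 4
  have h160 := omegaSum_nonneg n 16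
  have hn : (n : ℝ) ≤ n + 1 := by linarith
  calc _ ≤ _ := Finset.sum_le_sum fun q₁ h₁ => Finset.sum_le_sum fun q₂ h₂ => hpt q₁ h₁ q₂ h₂
    _ ≤ _ := hsum
    _ = _ := hfac
    _ ≤ (omegaSum n 4 * (2 * (n ^ 2 * (2 * exp π * omegaSum n 16 *
      √(2 * exp π * (19 / 20) ^ min L B))))) * (omegaSum n 4 * omegaSum n 4) :=
        mul_le_mul_of_nonneg_right (sum_lcm_kernSum_le hM hL hB) (by positivity)
    -- The exponents 4 + 2 + 16 + 4 + 4 make the final 30.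
    _ ≤ ((n + 1) ^ 4 * (2 * ((n + 1) ^ 2 * (2 * exp π * (n + 1) ^ 16 *
      √(2 * exp π * (19 / 20) ^ min L B))))) * ((n + 1) ^ 4 * (n + 1) ^ 4) := by gcongr
    _ = _ := by rw [Real.sqrt_mul (by positivity)]; ring

/-! ### Exponential sums over binary digits. -/

theorem sum_prod_binary_digits (g : ℕ → ℕ → ℂ) (n : ℕ) :
    ∑ a ∈ Finset.range (2 ^ n), ∏ j ∈ Finset.range n, g j (a / 2 ^ j % 2) =
      ∏ j ∈ Finset.range n, (g j 0 + g j 1) := by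
  induction n with
  | zero => simp
  | succ n ih =>
    rw [pow_succ, mul_two, Finset.sum_range_add, Finset.prod_range_succ, ← ih, mul_add,
      Finset.sum_mul, Finset.sum_mul]
    congr 1
    · refine Finset.sum_congr rfl fun a ha => ?_
      rw [Finset.prod_range_succ, Nat.div_eq_of_lt (Finset.mem_range.1 ha)]
    · refine Finset.sum_congr rfl fun a ha => ?_
      have ha' := Finset.mem_range.1 ha
      rw [Finset.prod_range_succ]
      congr 1
      · refine Finset.prod_congr rfl fun j hj => ?_
        have hj' := Finset.mem_range.1 hj
        congr 1
        obtain ⟨k, rfl⟩ : ∃ k, n = j + (k + 1) := ⟨n - j - 1, by omega⟩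
        rw [pow_add, Nat.mul_add_div (by positivity), pow_succ, mul_comm (2 ^ k), Nat.mul_add_mod]
      · rw [Nat.add_div_left _ (by positivity), Nat.div_eq_of_lt ha']

theorem sum_binary_digits (a n : ℕ) :
    ∑ j ∈ Finset.range n, (a / 2 ^ j % 2) * 2 ^ j = a % 2 ^ n := by
  induction n with
  | zero => simp [Nat.mod_one]
  | succ n ih => rw [Finset.sum_range_succ, ih, Nat.mod_pow_succ, mul_comm]

theorem mem_oddBits_iff {n a : ℕ} (hn : 1 ≤ n) :
    a ∈ oddBits n ↔ a < 2 ^ n ∧ a / 2 ^ 0 % 2 = 1 ∧ a / 2 ^ (n - 1) % 2 = 1 := by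
  obtain ⟨m, rfl⟩ : ∃ m, n = m + 1 := ⟨n - 1, by omega⟩
  simp only [oddBits, Finset.mem_filter, Finset.mem_Ico, Nat.add_sub_cancel, pow_zero, Nat.div_one,
    Nat.odd_iff]
  constructor
  · rintro ⟨⟨h1, h2⟩, h3⟩
    refine ⟨h2, h3, ?_⟩
    have : a / 2 ^ m = 1 := by
      rw [pow_succ] at h2
      exact Nat.div_eq_of_lt_le (by omega) (by omega)
    rw [this]
  · rintro ⟨h1, h2, h3⟩
    refine ⟨⟨?_, h1⟩, h2⟩
    by_contra h
    rw [Nat.div_eq_of_lt (by omega)] at h3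
    omega

/-- The additive character `x ↦ exp (2 π i x)`. -/
noncomputable def expI (x : ℝ) : ℂ := Complex.exp ((2 * Real.pi * x : ℝ) * Complex.I)

theorem expI_add (x y : ℝ) : expI (x + y) = expI x * expI y := by
  unfold expI
  rw [← Complex.exp_add]
  congr 1
  push_cast; ring

theorem expI_zero : expI 0 = 1 := by simp [expI]

theorem expI_sum {ι : Type*} (s : Finset ι) (x : ι → ℝ) :
    expI (∑ i ∈ s, x i) = ∏ i ∈ s, expI (x i) := by
  classical
  induction s using Finset.induction_on with
  | empty => simp [expI_zero]
  | insert i s hi ih => rw [Finset.sum_insert hi, Finset.prod_insert hi, expI_add, ih]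

theorem norm_expI (x : ℝ) : ‖expI x‖ = 1 := Complex.norm_exp_ofReal_mul_I _

theorem norm_one_add_expI (x : ℝ) : ‖1 + expI x‖ = 2 * |Real.cos (Real.pi * x)| := by
  have h : 1 + expI x = expI (x / 2) * ((2 * Real.cos (Real.pi * x) : ℝ) : ℂ) := by
    have e1 : expI x = expI (x / 2) * expI (x / 2) := by rw [← expI_add]; ring_nf
    have e2 : (1 : ℂ) = expI (x / 2) * expI (-(x / 2)) := by
      rw [← expI_add, add_neg_cancel, expI_zero]
    have e3 : ((2 * Real.cos (Real.pi * x) : ℝ) : ℂ) = expI (-(x / 2)) + expI (x / 2) := by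
      push_cast
      rw [Complex.two_cos, expI, expI, add_comm]
      congr 2 <;> (push_cast; ring)
    rw [e3, mul_add, ← e2, ← e1]
  rw [h, norm_mul, norm_expI, one_mul, Complex.norm_real, Real.norm_eq_abs, abs_mul, abs_two]

/-- The exponential sum over the odd `n`-bit integers and their reverses. -/
noncomputable def expSum (n : ℕ) (x y : ℝ) : ℂ :=
  ∑ a ∈ oddBits n, expI (x * a + y * mirror n a)

theorem norm_expSum_le {n : ℕ} (hn : 1 ≤ n) (x y : ℝ) : ‖expSum n x y‖ ≤ 2 ^ n * kern n x y := by
  classical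
  -- Weights vanishing unless both end digits equal 1 extend the sum to all digit strings, where it
  -- factors.
  set g : ℕ → ℕ → ℂ := fun j b =>
    if (j = 0 ∨ j = n - 1) ∧ b ≠ 1 then 0 else expI (b * (x * 2 ^ j + y * 2 ^ (n - 1 - j))) with hg
  have hsum : expSum n x y =
      ∑ a ∈ Finset.range (2 ^ n), ∏ j ∈ Finset.range n, g j (a / 2 ^ j % 2) := by
    have hsub : oddBits n ⊆ Finset.range (2 ^ n) := fun a ha =>
      Finset.mem_range.2 ((mem_oddBits_iff hn).1 ha).1
    rw [← Finset.sum_subset hsub, expSum]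
    · refine Finset.sum_congr rfl fun a ha => ?_
      obtain ⟨h1, h2, h3⟩ := (mem_oddBits_iff hn).1 ha
      have e : ∏ j ∈ Finset.range n, g j (a / 2 ^ j % 2) = ∏ j ∈ Finset.range n,
          expI ((a / 2 ^ j % 2 : ℕ) * (x * 2 ^ j + y * 2 ^ (n - 1 - j))) := by
        refine Finset.prod_congr rfl fun j _ => ?_
        simp only [hg]
        rw [if_neg]
        rintro ⟨rfl | rfl, h⟩
        · exact h h2
        · exact h h3
      rw [e, ← expI_sum]
      congr 1
      have ha2 : (a : ℝ) = ∑ j ∈ Finset.range n, ((a / 2 ^ j % 2 : ℕ) : ℝ) * 2 ^ j := by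
        have := sum_binary_digits a n
        rw [Nat.mod_eq_of_lt h1] at this
        exact_mod_cast this.symm
      have hm : (mirror n a : ℝ) =
          ∑ j ∈ Finset.range n, ((a / 2 ^ j % 2 : ℕ) : ℝ) * 2 ^ (n - 1 - j) := by
        unfold mirror; push_cast; rfl
      rw [hm]
      nth_rewrite 1 [ha2]
      rw [Finset.mul_sum, Finset.mul_sum, ← Finset.sum_add_distrib]
      exact Finset.sum_congr rfl fun j _ => by ring
    · intro a ha hna
      have ha' := Finset.mem_range.1 ha
      have : ∃ j ∈ Finset.range n, g j (a / 2 ^ j % 2) = 0 := by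
        by_contra! hcon
        refine hna ((mem_oddBits_iff hn).2 ⟨ha', ?_, ?_⟩)
        · by_contra hne
          exact hcon 0 (Finset.mem_range.2 hn) (if_pos ⟨Or.inl rfl, hne⟩)
        · by_contra hne
          exact hcon (n - 1) (Finset.mem_range.2 (by omega)) (if_pos ⟨Or.inr rfl, hne⟩)
      obtain ⟨j, hj, h0⟩ := this
      exact Finset.prod_eq_zero hj h0
  rw [hsum, sum_prod_binary_digits, norm_prod]
  calc _ ≤ ∏ j ∈ Finset.range n, (2 * if j ∈ Finset.Ico 1 (n - 1) then
        |Real.cos (Real.pi * (x * 2 ^ j + y * 2 ^ (n - 1 - j)))| else 1) := by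
        refine Finset.prod_le_prod (fun _ _ => norm_nonneg _) fun j hj => ?_
        have hj' := Finset.mem_range.1 hj
        split_ifs with h
        · rw [Finset.mem_Ico] at h
          have h' : ¬ (j = 0 ∨ j = n - 1) := by omega
          simp only [hg, h', false_and, if_false, Nat.cast_zero, zero_mul, expI_zero, Nat.cast_one,
            one_mul, norm_one_add_expI, le_refl]
        · rw [Finset.mem_Ico] at h
          have h' : j = 0 ∨ j = n - 1 := by omega
          simp only [hg, h', true_and, ne_eq, zero_ne_one, not_false_eq_true, if_true,
            not_true_eq_false, if_false, zero_add, norm_expI]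
          norm_num
    _ = _ := by
        rw [Finset.prod_mul_distrib, Finset.prod_const, Finset.card_range, Finset.prod_ite_mem,
          Finset.inter_eq_right.2]
        · rfl
        · intro j hj
          rw [Finset.mem_Ico] at hj
          exact Finset.mem_range.2 (by omega)

theorem sum_expI_eq (q a : ℕ) (hq : 0 < q) :
    ∑ h ∈ Finset.range q, expI ((h : ℝ) / q * a) = if q ∣ a then (q : ℂ) else 0 := by
  have hq' : (q : ℝ) ≠ 0 := by positivity
  have hpow : ∀ h : ℕ, expI ((h : ℝ) / q * a) = (expI ((a : ℝ) / q)) ^ h := by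
    intro h
    unfold expI
    rw [← Complex.exp_nat_mul]
    congr 1
    push_cast; ring
  simp only [hpow]
  have hprim := Complex.isPrimitiveRoot_exp q hq.ne'
  have hz : expI ((a : ℝ) / q) = Complex.exp (2 * Real.pi * Complex.I / q) ^ a := by
    rw [← Complex.exp_nat_mul, expI]
    congr 1
    push_cast; ring
  split_ifs with h
  · rw [hz, (hprim.pow_eq_one_iff_dvd a).2 h]
    simp
  · have hne : expI ((a : ℝ) / q) ≠ 1 := by
      rw [hz]
      exact fun h1 => h ((hprim.pow_eq_one_iff_dvd a).1 h1)
    have hq1 : expI ((a : ℝ) / q) ^ q = 1 := by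
      rw [hz, ← pow_mul, mul_comm a q, pow_mul, hprim.pow_eq_one, one_pow]
    rw [geom_sum_eq hne, hq1, sub_self, zero_div]

/-! ### Counting simultaneous divisibilities by characters. -/

/-- The number of odd `n`-bit integers `a` with `q₁ ∣ a` and `q₂` dividing the reverse of `a`. -/
def pairCount (n q₁ q₂ : ℕ) : ℕ :=
  ((oddBits n).filter fun a => q₁ ∣ a ∧ q₂ ∣ mirror n a).card

theorem mul_pairCount_eq (n : ℕ) {q₁ q₂ : ℕ} (h₁ : 0 < q₁) (h₂ : 0 < q₂) :
    (q₁ * q₂ * pairCount n q₁ q₂ : ℂ) = ∑ p ∈ Finset.range q₁ ×ˢ Finset.range q₂,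
      expSum n ((p.1 : ℝ) / q₁) ((p.2 : ℝ) / q₂) := by
  unfold expSum
  rw [Finset.sum_comm, pairCount, Finset.card_filter]
  push_cast
  rw [Finset.mul_sum]
  refine Finset.sum_congr rfl fun a _ => ?_
  rw [Finset.sum_product]
  simp only [expI_add]
  rw [← Finset.sum_mul_sum, sum_expI_eq _ _ h₁, sum_expI_eq _ _ h₂]
  by_cases c1 : q₁ ∣ a <;> by_cases c2 : q₂ ∣ mirror n a <;> simp [c1, c2]

theorem sum_range_le_sum_numerators {q : ℕ} (hq : 0 < q) (F : ℕ → ℝ) (hF : ∀ h, 0 ≤ F h) :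
    ∑ h ∈ Finset.range q, F h ≤ ∑ r ∈ q.divisors, ∑ k ∈ numerators r, F (k * (q / r)) := by
  rw [Finset.sum_sigma' q.divisors]
  set back : (Σ _ : ℕ, ℕ) → ℕ := fun p => p.2 * (q / p.1) with hback
  set fwd : ℕ → (Σ _ : ℕ, ℕ) := fun h => ⟨q / h.gcd q, h / h.gcd q⟩ with hfwd
  have hg : ∀ h : ℕ, 0 < h.gcd q := fun h => Nat.gcd_pos_of_pos_right h hq
  have hbf : ∀ h, back (fwd h) = h := by
    intro h
    simp only [hback, hfwd]
    rw [Nat.div_div_self (Nat.gcd_dvd_right _ _) hq.ne', Nat.div_mul_cancel (Nat.gcd_dvd_left _ _)]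
  have hinj : Function.Injective fwd := fun x y h => by rw [← hbf x, ← hbf y, h]
  calc _ = ∑ h ∈ Finset.range q, F (back (fwd h)) := by simp only [hbf]
    _ = ∑ p ∈ (Finset.range q).image fwd, F (back p) := by
        rw [Finset.sum_image hinj.injOn]
    _ ≤ _ := by
        refine Finset.sum_le_sum_of_subset_of_nonneg ?_ fun _ _ _ => hF _
        intro p hp
        obtain ⟨h, hh, rfl⟩ := Finset.mem_image.1 hp
        have hh' := Finset.mem_range.1 hh
        simp only [hfwd, Finset.mem_sigma, Nat.mem_divisors, numerators, Finset.mem_filter,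
          Finset.mem_range]
        refine ⟨⟨Nat.div_dvd_of_dvd (Nat.gcd_dvd_right _ _), hq.ne'⟩, ?_,
          Nat.coprime_div_gcd_div_gcd (hg h)⟩
        exact Nat.div_lt_div_of_lt_of_dvd (Nat.gcd_dvd_right _ _) hh'

/-- Since q and q₂ are prime to 3, a frequency pair whose reduced denominators both divide 3 has q ∣
h₁ and h₂ = 0, and is thus one of the excluded ones. -/
theorem sum_nontrivial_kern_le {n κ q q₂ : ℕ} (hκ : 0 < κ) (hq : 0 < q) (hq₂ : 0 < q₂)
    (h3 : q.Coprime 3) (h3' : q₂.Coprime 3) :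
    ∑ p ∈ (Finset.range (κ * q) ×ˢ Finset.range q₂).filter (fun p => ¬ (q ∣ p.1 ∧ p.2 = 0)),
      kern n ((p.1 : ℝ) / (κ * q : ℕ)) ((p.2 : ℝ) / q₂) ≤ divisorKernSum n (κ * q) q₂ := by
  set F : ℕ → ℕ → ℝ := fun h₁ h₂ => if ¬ (q ∣ h₁ ∧ h₂ = 0) then
    kern n ((h₁ : ℝ) / (κ * q : ℕ)) ((h₂ : ℝ) / q₂) else 0 with hF
  have hF0 : ∀ h₁ h₂, 0 ≤ F h₁ h₂ := by
    intro h₁ h₂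
    simp only [hF]
    split_ifs
    · exact le_rfl
    · exact kern_nonneg _ _ _
  have hκq : 0 < κ * q := Nat.mul_pos hκ hq
  rw [Finset.sum_filter, Finset.sum_product]
  calc _ = ∑ h₁ ∈ Finset.range (κ * q), ∑ h₂ ∈ Finset.range q₂, F h₁ h₂ := rfl
    _ ≤ ∑ r₁ ∈ (κ * q).divisors, ∑ k₁ ∈ numerators r₁, ∑ h₂ ∈ Finset.range q₂,
        F (k₁ * (κ * q / r₁)) h₂ :=
        sum_range_le_sum_numerators hκq (fun h₁ => ∑ h₂ ∈ Finset.range q₂, F h₁ h₂)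
          fun h₁ => Finset.sum_nonneg fun _ _ => hF0 _ _
    _ ≤ ∑ r₁ ∈ (κ * q).divisors, ∑ k₁ ∈ numerators r₁, ∑ r₂ ∈ q₂.divisors, ∑ k₂ ∈ numerators r₂,
        F (k₁ * (κ * q / r₁)) (k₂ * (q₂ / r₂)) :=
        Finset.sum_le_sum fun r₁ _ => Finset.sum_le_sum fun k₁ _ =>
          sum_range_le_sum_numerators hq₂ _ fun h₂ => hF0 _ _
    _ = ∑ r₁ ∈ (κ * q).divisors, ∑ r₂ ∈ q₂.divisors, ∑ k₁ ∈ numerators r₁, ∑ k₂ ∈ numerators r₂,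
        F (k₁ * (κ * q / r₁)) (k₂ * (q₂ / r₂)) :=
        Finset.sum_congr rfl fun r₁ _ => Finset.sum_comm
    _ ≤ _ := by
        refine Finset.sum_le_sum fun r₁ hr₁ => Finset.sum_le_sum fun r₂ hr₂ => ?_
        have d1 := Nat.dvd_of_mem_divisors hr₁
        have d2 := Nat.dvd_of_mem_divisors hr₂
        have p1 := Nat.pos_of_dvd_of_pos d1 hκq
        have p2 := Nat.pos_of_dvd_of_pos d2 hq₂
        split_ifs with h
        · refine le_of_eq (Finset.sum_eq_zero fun k₁ hk₁ => Finset.sum_eq_zero fun k₂ hk₂ => ?_)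
          refine if_neg (not_not.2 ⟨?_, ?_⟩)
          · have hc : q.Coprime r₁ := Nat.Coprime.coprime_dvd_right h.1 h3
            refine hc.dvd_of_dvd_mul_left (k := q) (m := r₁) ?_
            refine ⟨k₁ * κ, ?_⟩
            rw [mul_left_comm, Nat.mul_div_cancel' d1]; ring
          · have : r₂ = 1 := Nat.eq_one_of_dvd_coprimes h3' d2 h.2
            subst this
            have := Finset.mem_range.1 (Finset.mem_filter.1 hk₂).1
            obtain rfl : k₂ = 0 := by omega
            simp
        · refine Finset.sum_le_sum fun k₁ hk₁ => Finset.sum_le_sum fun k₂ hk₂ => ?_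
          have frac : ∀ {Q r : ℕ} (k : ℕ), r ∣ Q → 0 < Q →
              ((k * (Q / r) : ℕ) : ℝ) / Q = k / r := by
            intro Q r k hd hQ
            obtain ⟨t, rfl⟩ := hd
            have hr : 0 < r := Nat.pos_of_mul_pos_right hQ
            have ht : 0 < t := Nat.pos_of_mul_pos_left hQ
            rw [Nat.mul_div_cancel_left _ hr]
            push_cast
            field_simp
          simp only [hF]
          rw [frac k₁ d1 hκq, frac k₂ d2 hq₂]
          split_ifs
          · exact kern_nonneg _ _ _
          · exact le_rfl

/-- The frequencies with q ∣ h₁ and h₂ = 0 are the multiples of 1/κ in the first variable; they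
reassemble into κ times `pairCount n κ 1`. -/
theorem abs_pairCount_sub_le {n κ q q₂ : ℕ} (hn : 1 ≤ n) (hκ : 0 < κ) (hq : 0 < q) (hq₂ : 0 < q₂)
    (h3 : q.Coprime 3) (h3' : q₂.Coprime 3) :
    |(pairCount n (κ * q) q₂ : ℝ) - pairCount n κ 1 / (q * q₂)| ≤
      2 ^ n * (divisorKernSum n (κ * q) q₂ / ((κ * q : ℕ) * q₂)) := by
  have hκ' : (0 : ℝ) < κ := by exact_mod_cast hκ
  have hq' : (0 : ℝ) < q := by exact_mod_cast hq
  have hq₂' : (0 : ℝ) < q₂ := by exact_mod_cast hq₂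
  set S := Finset.range (κ * q) ×ˢ Finset.range q₂ with hS
  set E : ℕ × ℕ → ℂ := fun p => expSum n ((p.1 : ℝ) / (κ * q : ℕ)) ((p.2 : ℝ) / q₂) with hE
  have h1 := mul_pairCount_eq n (Nat.mul_pos hκ hq) hq₂
  have h2 := mul_pairCount_eq n hκ one_pos
  have hmain : ∑ p ∈ S.filter (fun p => q ∣ p.1 ∧ p.2 = 0), E p =
      ∑ p ∈ Finset.range κ ×ˢ Finset.range 1, expSum n ((p.1 : ℝ) / κ) ((p.2 : ℝ) / (1 : ℕ)) := by
    symm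
    refine Finset.sum_nbij (fun p => (p.1 * q, 0)) ?_ ?_ ?_ ?_
    · rintro ⟨i, j⟩ hp
      simp only [hS, Finset.mem_product, Finset.mem_range, Finset.mem_filter] at hp ⊢
      exact ⟨⟨Nat.mul_lt_mul_of_pos_right hp.1 hq, hq₂⟩, dvd_mul_left _ _, trivial⟩
    · rintro ⟨i, j⟩ hp ⟨i', j'⟩ hp' h
      simp only [Finset.coe_product, Finset.coe_range, Set.mem_prod, Set.mem_Iio] at hp hp'
      simp only [Prod.mk.injEq, and_true] at h
      have := Nat.eq_of_mul_eq_mul_right hq h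
      ext <;> simp <;> omega
    · rintro ⟨h, j⟩ hp
      simp only [hS, Finset.coe_filter, Finset.mem_product, Finset.mem_range, Set.mem_ofPred_eq]
        at hp
      obtain ⟨⟨a1, a2⟩, ⟨i, rfl⟩, rfl⟩ := hp
      refine ⟨(i, 0), ?_, ?_⟩
      · simp only [Finset.coe_product, Finset.coe_range, Set.mem_prod, Set.mem_Iio]
        refine ⟨?_, one_pos⟩
        rw [mul_comm] at a1
        exact Nat.lt_of_mul_lt_mul_right a1
      · simp [mul_comm]
    · rintro ⟨i, j⟩ hp
      simp only [Finset.mem_product, Finset.mem_range] at hp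
      obtain rfl : j = 0 := by omega
      simp only [hE]
      congr 1
      · push_cast; field_simp
      · simp
  have hsplit := Finset.sum_filter_add_sum_filter_not S (fun p => q ∣ p.1 ∧ p.2 = 0) E
  rw [hmain, ← h2, ← h1] at hsplit
  have hrest : ‖∑ p ∈ S.filter (fun p => ¬ (q ∣ p.1 ∧ p.2 = 0)), E p‖ ≤
      2 ^ n * divisorKernSum n (κ * q) q₂ := by
    refine (norm_sum_le _ _).trans ((Finset.sum_le_sum fun p _ => norm_expSum_le hn _ _).trans ?_)
    rw [← Finset.mul_sum]
    exact mul_le_mul_of_nonneg_left (sum_nontrivial_kern_le hκ hq hq₂ h3 h3') (by positivity)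
  have hval : ∑ p ∈ S.filter (fun p => ¬ (q ∣ p.1 ∧ p.2 = 0)), E p =
      (((κ * q : ℕ) * q₂ * ((pairCount n (κ * q) q₂ : ℝ) - pairCount n κ 1 / (q * q₂)) : ℝ) : ℂ) := by
    have hqc : (q : ℂ) ≠ 0 := by exact_mod_cast hq.ne'
    have hq₂c : (q₂ : ℂ) ≠ 0 := by exact_mod_cast hq₂.ne'
    rw [eq_sub_of_add_eq' hsplit]
    push_cast
    field_simp
  rw [hval, Complex.norm_real, Real.norm_eq_abs, abs_mul,
    abs_of_pos (show (0 : ℝ) < (κ * q : ℕ) * q₂ by positivity)] at hrest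
  rw [← mul_div_assoc, le_div_iff₀ (by positivity), mul_comm]
  exact hrest

/-! ### From divisibility of the product to pair counts. -/

open ArithmeticFunction in
-- Only e = gcd(x, d) survives: the Möbius sum over f tests that x/e is coprime to d/e. Then d ∣ xy
-- amounts to d/e ∣ y.
theorem ite_dvd_mul_eq (d x y : ℕ) (hd : 0 < d) (hx : 0 < x) :
    (if d ∣ x * y then (1 : ℤ) else 0) = ∑ e ∈ d.divisors, ∑ f ∈ (d / e).divisors,
      moebius f * if e * f ∣ x ∧ d / e ∣ y then 1 else 0 := by
  have inner : ∀ e ∈ d.divisors, ∑ f ∈ (d / e).divisors,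
      moebius f * (if e * f ∣ x ∧ d / e ∣ y then 1 else 0) =
      if e = x.gcd d then (if d / e ∣ y then (1 : ℤ) else 0) else 0 := by
    intro e he
    have hed := Nat.dvd_of_mem_divisors he
    have he0 : 0 < e := Nat.pos_of_dvd_of_pos hed hd
    have hde : 0 < d / e := Nat.div_pos (Nat.le_of_dvd hd hed) he0
    by_cases hex : e ∣ x
    · obtain ⟨x', rfl⟩ := hex
      have hgcd : e = (e * x').gcd d ↔ x'.gcd (d / e) = 1 := by
        obtain ⟨d', rfl⟩ := hed
        rw [Nat.mul_div_cancel_left _ he0, Nat.gcd_mul_left]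
        constructor
        · intro h
          exact Nat.eq_of_mul_eq_mul_left he0 (by rw [mul_one]; exact h.symm)
        · intro h; rw [h, mul_one]
      have hx' : 0 < x' := Nat.pos_of_mul_pos_left hx
      have hsum : ∑ f ∈ (d / e).divisors,
          moebius f * (if e * f ∣ e * x' ∧ d / e ∣ y then 1 else 0) =
          (∑ f ∈ (x'.gcd (d / e)).divisors, moebius f) * (if d / e ∣ y then (1 : ℤ) else 0) := by
        have hfil : (x'.gcd (d / e)).divisors = (d / e).divisors.filter fun f => f ∣ x' := by
          ext f
          simp only [Nat.mem_divisors, Finset.mem_filter, Nat.dvd_gcd_iff, ne_eq,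
            Nat.gcd_eq_zero_iff]
          constructor
          · rintro ⟨⟨a, b⟩, _⟩; exact ⟨⟨b, hde.ne'⟩, a⟩
          · rintro ⟨⟨a, _⟩, b⟩; exact ⟨⟨b, a⟩, fun h => hde.ne' h.2⟩
        rw [hfil, Finset.sum_filter, Finset.sum_mul]
        refine Finset.sum_congr rfl fun f _ => ?_
        have : e * f ∣ e * x' ↔ f ∣ x' := Nat.mul_dvd_mul_iff_left he0
        by_cases c1 : f ∣ x' <;> by_cases c2 : d / e ∣ y <;> simp [this, c1, c2]
      rw [hsum, ← coe_mul_zeta_apply, moebius_mul_coe_zeta, one_apply]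
      by_cases h1 : x'.gcd (d / e) = 1
      · rw [if_pos h1, if_pos (hgcd.2 h1), one_mul]
      · rw [if_neg h1, if_neg fun h => h1 (hgcd.1 h), zero_mul]
    · rw [if_neg]
      · refine Finset.sum_eq_zero fun f _ => ?_
        rw [if_neg, mul_zero]
        exact fun h => hex ((dvd_mul_right e f).trans h.1)
      · rintro rfl
        exact hex (Nat.gcd_dvd_left _ _)
  have hmem : x.gcd d ∈ d.divisors := Nat.mem_divisors.2 ⟨Nat.gcd_dvd_right _ _, hd.ne'⟩
  rw [Finset.sum_congr rfl inner, Finset.sum_ite_eq', if_pos hmem]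
  have hg : 0 < x.gcd d := Nat.gcd_pos_of_pos_right x hd
  have : d ∣ x * y ↔ d / x.gcd d ∣ y := by
    constructor
    · intro h
      have h2 : d / x.gcd d ∣ x / x.gcd d * y := by
        obtain ⟨z, hz⟩ := h
        refine ⟨z, Nat.eq_of_mul_eq_mul_left hg ?_⟩
        rw [← mul_assoc, ← mul_assoc, Nat.mul_div_cancel' (Nat.gcd_dvd_left _ _),
          Nat.mul_div_cancel' (Nat.gcd_dvd_right _ _), hz]
      exact (Nat.coprime_div_gcd_div_gcd hg).symm.dvd_of_dvd_mul_left h2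
    · intro h
      rw [← Nat.mul_div_cancel' (Nat.gcd_dvd_right x d)]
      exact mul_dvd_mul (Nat.gcd_dvd_left _ _) h
  by_cases h : d ∣ x * y
  · rw [if_pos h, if_pos (this.1 h)]
  · rw [if_neg h, if_neg fun h' => h (this.2 h')]

/-- Because 2 ≡ -1 mod 3, reversal multiplies the residue by (-1)^(n-1). This explains f(3) = 1. -/
theorem three_dvd_mirror_iff {n a : ℕ} (hn : 1 ≤ n) (ha : a < 2 ^ n) : 3 ∣ mirror n a ↔ 3 ∣ a := by
  have h2 : (2 : ZMod 3) = -1 := by decide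
  have e1 : (a : ZMod 3) = ∑ j ∈ Finset.range n, ((a / 2 ^ j % 2 : ℕ) : ZMod 3) * (-1) ^ j := by
    have := sum_binary_digits a n
    rw [Nat.mod_eq_of_lt ha] at this
    conv_lhs => rw [← this]
    push_cast
    rw [h2]
  have e2 : (mirror n a : ZMod 3) = (-1) ^ (n - 1) * a := by
    rw [e1, mirror, Finset.mul_sum]
    push_cast
    rw [h2]
    refine Finset.sum_congr rfl fun j hj => ?_
    have hj' := Finset.mem_range.1 hj
    obtain ⟨k, hk⟩ : ∃ k, n - 1 = k + j := ⟨n - 1 - j, by omega⟩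
    rw [hk, Nat.add_sub_cancel, pow_add]
    have : ((-1 : ZMod 3)) ^ j * (-1) ^ j = 1 := by rw [← mul_pow]; simp
    linear_combination (-((a / 2 ^ j % 2 : ℕ) : ZMod 3) * (-1) ^ k) * this
  rw [← ZMod.natCast_eq_zero_iff, ← ZMod.natCast_eq_zero_iff, e2]
  constructor
  · intro h
    have h3 : (-1 : ZMod 3) ^ (n - 1) * (-1) ^ (n - 1) = 1 := by rw [← mul_pow]; simp
    calc (a : ZMod 3) = ((-1) ^ (n - 1) * (-1) ^ (n - 1)) * a := by rw [h3, one_mul]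
      _ = (-1) ^ (n - 1) * ((-1) ^ (n - 1) * a) := by ring
      _ = 0 := by rw [h, mul_zero]
  · intro h; rw [h, mul_zero]

theorem dvd_mul_mirror_iff {n a κ d : ℕ} (hn : 1 ≤ n) (ha : a < 2 ^ n) (hκ : κ = 1 ∨ κ = 3)
    (hd : d.Coprime 3) : κ * d ∣ a * mirror n a ↔ κ ∣ a ∧ d ∣ a * mirror n a := by
  rcases hκ with rfl | rfl
  · simp
  · constructor
    · intro h
      refine ⟨?_, (dvd_mul_left _ _).trans h⟩
      rcases (Nat.prime_three.dvd_mul).1 ((dvd_mul_right 3 d).trans h) with h1 | h1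
      · exact h1
      · exact (three_dvd_mirror_iff hn ha).1 h1
    · rintro ⟨h1, h2⟩
      exact hd.symm.mul_dvd_of_dvd_of_dvd (h1.trans (dvd_mul_right _ _)) h2

open ArithmeticFunction in
theorem T_eq_sum_pairCount {n κ d : ℕ} (hn : 1 ≤ n) (hκ : κ = 1 ∨ κ = 3) (hd0 : 0 < d)
    (hd : d.Coprime 3) :
    (T n (κ * d) : ℤ) = ∑ e ∈ d.divisors, ∑ f ∈ (d / e).divisors,
      moebius f * (pairCount n (κ * (e * f)) (d / e) : ℤ) := by
  rw [T, Finset.card_filter]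
  push_cast
  have hterm : ∀ a ∈ oddBits n, (if κ * d ∣ a * mirror n a then (1 : ℤ) else 0) =
      ∑ e ∈ d.divisors, ∑ f ∈ (d / e).divisors,
        moebius f * if κ * (e * f) ∣ a ∧ d / e ∣ mirror n a then 1 else 0 := by
    intro a ha
    have ha2 := ((mem_oddBits_iff hn).1 ha).1
    have ha0 : 0 < a := (Finset.mem_filter.1 ha).2.pos
    have hite := ite_dvd_mul_eq d a (mirror n a) hd0 ha0
    have h1 : (if κ * d ∣ a * mirror n a then (1 : ℤ) else 0) =
        (if κ ∣ a then 1 else 0) * (if d ∣ a * mirror n a then 1 else 0) := by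
      by_cases c1 : κ ∣ a <;> by_cases c2 : d ∣ a * mirror n a <;>
        simp [dvd_mul_mirror_iff hn ha2 hκ hd, c1, c2]
    rw [h1, hite, Finset.mul_sum]
    refine Finset.sum_congr rfl fun e he => ?_
    rw [Finset.mul_sum]
    refine Finset.sum_congr rfl fun f hf => ?_
    have hef : e * f ∣ d := by
      obtain ⟨t, ht⟩ := Nat.dvd_of_mem_divisors hf
      refine ⟨t, ?_⟩
      rw [mul_assoc, ← ht, Nat.mul_div_cancel' (Nat.dvd_of_mem_divisors he)]
    have hc : κ.Coprime (e * f) := by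
      rcases hκ with rfl | rfl
      · exact Nat.coprime_one_left _
      · exact (Nat.Coprime.coprime_dvd_left hef hd).symm
    have hiff : κ * (e * f) ∣ a ↔ κ ∣ a ∧ e * f ∣ a :=
      ⟨fun h => ⟨(dvd_mul_right _ _).trans h, (dvd_mul_left _ _).trans h⟩,
        fun h => hc.mul_dvd_of_dvd_of_dvd h.1 h.2⟩
    by_cases c1 : κ ∣ a <;> by_cases c2 : e * f ∣ a <;> simp [hiff, c1, c2]
  rw [Finset.sum_congr rfl hterm, Finset.sum_comm]
  refine Finset.sum_congr rfl fun e _ => ?_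
  rw [Finset.sum_comm]
  refine Finset.sum_congr rfl fun f _ => ?_
  rw [← Finset.mul_sum, pairCount, Finset.card_filter]
  push_cast
  rfl

/-! ### The function f and the main term. -/

theorem f_eq_prod {d : ℕ} (hd : Squarefree d) : f d = ∏ p ∈ d.primeFactors, fPrime p := by
  have h : f d = if d = 0 then 0 else
      d.factorization.prod (fun p k => if k = 1 then fPrime p else 0) := rfl
  rw [h, if_neg hd.ne_zero, Finsupp.prod, Nat.support_factorization]
  refine Finset.prod_congr rfl fun p hp => ?_
  rw [if_pos]
  have h1 := (Nat.squarefree_iff_factorization_le_one hd.ne_zero).1 hd p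
  have h2 := (Nat.prime_of_mem_primeFactors hp).factorization_pos_of_dvd hd.ne_zero
    (Nat.dvd_of_mem_primeFactors hp)
  omega

theorem f_three_mul {d : ℕ} (h3 : d.Coprime 3) (hd : Squarefree d) : f (3 * d) = f d := by
  have hsq : Squarefree (3 * d) :=
    (Nat.squarefree_mul h3.symm).2 ⟨Nat.prime_three.squarefree, hd⟩
  rw [f_eq_prod hsq, f_eq_prod hd, Nat.Coprime.primeFactors_mul h3.symm,
    Finset.prod_union h3.symm.disjoint_primeFactors, Nat.prime_three.primeFactors,
    Finset.prod_singleton]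
  norm_num [fPrime]

theorem fPrime_eq {p : ℕ} (hp : p.Prime) (h2 : p ≠ 2) (h3 : p ≠ 3) :
    fPrime p = 1 + (1 - (p : ℝ)⁻¹) := by
  have : (p : ℝ) ≠ 0 := by exact_mod_cast hp.ne_zero
  rw [fPrime, if_neg h2, if_neg h3]
  field_simp; ring

open ArithmeticFunction in
-- The inner sum is ∏ (1 - 1/p) over p ∣ d/e, and summing over e expands ∏ (1 + (1 - 1/p)), whose
-- factors are (2p - 1)/p.
theorem sum_moebius_div_eq_f {d : ℕ} (hd : Squarefree d) (h2 : Odd d) (h3 : d.Coprime 3) :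
    ∑ e ∈ d.divisors, ∑ f ∈ (d / e).divisors, (moebius f : ℝ) * (f : ℝ)⁻¹ = f d := by
  have hne : ∀ p ∈ d.primeFactors, p ≠ 2 ∧ p ≠ 3 := by
    intro p hp
    have hpd := Nat.dvd_of_mem_primeFactors hp
    constructor
    · rintro rfl
      exact (Nat.not_even_iff_odd.2 h2) (even_iff_two_dvd.2 hpd)
    · rintro rfl
      have := Nat.Coprime.eq_one_of_dvd (h3.symm) hpd
      omega
  rw [Nat.sum_div_divisors d (fun m => ∑ f ∈ m.divisors, (moebius f : ℝ) * (f : ℝ)⁻¹)]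
  have hinner : ∀ e ∈ d.divisors, ∑ f ∈ e.divisors, (moebius f : ℝ) * (f : ℝ)⁻¹ =
      ∏ p ∈ e.primeFactors, (1 - (p : ℝ)⁻¹) := by
    intro e he
    set g : ArithmeticFunction ℝ := ⟨fun m => (m : ℝ)⁻¹, by simp⟩
    have hg : g.IsMultiplicative := ⟨by simp [g], fun {m n} _ => by simp [g, mul_comm]⟩
    exact (IsMultiplicative.prodPrimeFactors_one_sub_of_squarefree g hg
      (hd.squarefree_of_dvd (Nat.dvd_of_mem_divisors he))).symm
  have houter := (IsMultiplicative.prodPrimeFactors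
    (fun p : ℕ => 1 - (p : ℝ)⁻¹)).prodPrimeFactors_one_add_of_squarefree hd
  rw [Finset.sum_congr rfl hinner, f_eq_prod hd]
  calc _ = ∑ e ∈ d.divisors, prodPrimeFactors (fun p : ℕ => 1 - (p : ℝ)⁻¹) e :=
        Finset.sum_congr rfl fun e he =>
          (prodPrimeFactors_apply (Nat.pos_of_mem_divisors he).ne').symm
    _ = _ := houter.symm
    _ = _ := Finset.prod_congr rfl fun p hp => by
        have hpp := Nat.prime_of_mem_primeFactors hp
        rw [fPrime_eq hpp (hne p hp).1 (hne p hp).2, prodPrimeFactors_apply hpp.ne_zero,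
          hpp.primeFactors, Finset.prod_singleton]

open Real in
-- The value cos² = 1/4 is fixed under doubling of the angle, so all cosines have modulus 1/2. The 4
-- accounts for the two end digits.
theorem two_pow_mul_kern_le {n : ℕ} {x : ℝ} (hx : cos (π * x) ^ 2 = 1 / 4) :
    2 ^ n * kern n x 0 ≤ 4 := by
  have hj : ∀ j : ℕ, cos (π * (x * 2 ^ j)) ^ 2 = 1 / 4 := by
    intro j
    induction j with
    | zero => simpa using hx
    | succ j ih =>
      have e : π * (x * 2 ^ (j + 1)) = 2 * (π * (x * 2 ^ j)) := by ring
      rw [e, cos_two_mul, ih]; norm_num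
  have hk : kern n x 0 = (1 / 2) ^ (n - 1 - 1) := by
    unfold kern
    rw [Finset.prod_congr rfl (g := fun _ => (1 / 2 : ℝ)) fun j _ => ?_, Finset.prod_const,
      Nat.card_Ico]
    rw [zero_mul, add_zero, ← Real.sqrt_sq_eq_abs, hj]
    rw [show (1 / 4 : ℝ) = (1 / 2) ^ 2 by norm_num, Real.sqrt_sq (by norm_num)]
  rw [hk]
  have h2 : (2 : ℝ) ^ n ≤ 4 * 2 ^ (n - 1 - 1) := by
    have : n ≤ 2 + (n - 1 - 1) := by omega
    calc (2 : ℝ) ^ n ≤ 2 ^ (2 + (n - 1 - 1)) := pow_le_pow_right₀ (by norm_num) this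
      _ = _ := by rw [pow_add]; norm_num
  rw [one_div, inv_pow, ← div_eq_mul_inv, div_le_iff₀ (by positivity)]
  exact h2

open Real in
theorem abs_pairCount_one_sub_le {n κ : ℕ} (hn : 1 ≤ n) (hκ : κ = 1 ∨ κ = 3) :
    |(pairCount n κ 1 : ℝ) - (oddBits n).card / κ| ≤ 4 := by
  rcases hκ with rfl | rfl
  · simp [pairCount]
  · have h := mul_pairCount_eq n (q₁ := 3) (q₂ := 1) (by norm_num) one_pos
    rw [Finset.sum_product] at h
    simp only [Finset.sum_range_succ, Finset.range_zero, Finset.sum_empty, zero_add, Nat.cast_zero,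
      zero_div, Nat.cast_one, Nat.cast_ofNat, mul_one] at h
    have h0 : expSum n 0 0 = ((oddBits n).card : ℂ) := by simp [expSum, expI_zero]
    have c1 : cos (π * (1 / 3)) ^ 2 = 1 / 4 := by
      rw [mul_one_div, cos_pi_div_three]; norm_num
    have c2 : cos (π * (2 / 3)) ^ 2 = 1 / 4 := by
      have : π * (2 / 3) = 2 * (π * (1 / 3)) := by ring
      rw [this, cos_two_mul, c1]; norm_num
    have b1 := (norm_expSum_le hn (1 / 3) 0).trans (two_pow_mul_kern_le c1)
    have b2 := (norm_expSum_le hn (2 / 3) 0).trans (two_pow_mul_kern_le c2)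
    have hval : expSum n (1 / 3) 0 + expSum n (2 / 3) 0 =
        ((3 * ((pairCount n 3 1 : ℝ) - (oddBits n).card / 3) : ℝ) : ℂ) := by
      push_cast
      rw [← h0]
      linear_combination -h
    have h3 := (norm_add_le (expSum n (1 / 3) 0) (expSum n (2 / 3) 0)).trans (add_le_add b1 b2)
    rw [hval, Complex.norm_real, Real.norm_eq_abs, abs_mul, abs_of_pos (by norm_num : (0 : ℝ) < 3)]
      at h3
    push_cast
    linarith

theorem f_nonneg_of_squarefree {d : ℕ} (hd : Squarefree d) : 0 ≤ f d := by
  rw [f_eq_prod hd]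
  refine Finset.prod_nonneg fun p hp => ?_
  have : (1 : ℝ) ≤ p := by exact_mod_cast (Nat.prime_of_mem_primeFactors hp).one_le
  unfold fPrime
  split_ifs
  · exact le_rfl
  · exact zero_le_one
  · exact div_nonneg (by linarith) (by linarith)

theorem f_le_omegaPow {d : ℕ} (hd : Squarefree d) : f d ≤ omegaPow 2 d := by
  rw [f_eq_prod hd, omegaPow]
  push_cast
  rw [← Finset.prod_const]
  refine Finset.prod_le_prod (fun p hp => ?_) fun p hp => ?_
  all_goals
    have : (1 : ℝ) ≤ p := by exact_mod_cast (Nat.prime_of_mem_primeFactors hp).one_le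
    unfold fPrime
    split_ifs
  · exact le_rfl
  · exact zero_le_one
  · exact div_nonneg (by linarith) (by linarith)
  · norm_num
  · norm_num
  · rw [div_le_iff₀ (by linarith)]; linarith

/-! ### Bounding the error term and summing over d. -/

open ArithmeticFunction in
-- The error has two sources: comparing each pair count with its share of `pairCount n κ 1`, and
-- comparing the latter with the fraction 1/κ of all odd n-bit integers.
theorem abs_R_le {n κ d : ℕ} (hn : 1 ≤ n) (hκ : κ = 1 ∨ κ = 3) (hd : Squarefree d) (h2 : Odd d)
    (h3 : d.Coprime 3) :
    |R n (κ * d)| ≤ 4 * (f d / d) + 2 ^ n * ∑ e ∈ d.divisors, ∑ f ∈ (d / e).divisors,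
      divisorKernSum n (κ * (e * f)) (d / e) / ((κ * (e * f) : ℕ) * (d / e : ℕ)) := by
  have hd0 : 0 < d := h2.pos
  have hd' : (0 : ℝ) < d := by exact_mod_cast hd0
  have hκ0 : 0 < κ := by omega
  have hκ' : (0 : ℝ) < κ := by exact_mod_cast hκ0
  have hfκ : f (κ * d) = f d := by
    rcases hκ with rfl | rfl
    · rw [one_mul]
    · exact f_three_mul h3 hd
  have hT : (T n (κ * d) : ℝ) = ∑ e ∈ d.divisors, ∑ f ∈ (d / e).divisors,
      (moebius f : ℝ) * (pairCount n (κ * (e * f)) (d / e) : ℝ) := by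
    exact_mod_cast T_eq_sum_pairCount hn hκ hd0 h3
  have hM : f d / d * pairCount n κ 1 = ∑ e ∈ d.divisors, ∑ f ∈ (d / e).divisors,
      (moebius f : ℝ) * (pairCount n κ 1 / ((e * f : ℕ) * (d / e : ℕ))) := by
    rw [← sum_moebius_div_eq_f hd h2 h3, Finset.sum_div, Finset.sum_mul]
    refine Finset.sum_congr rfl fun e he => ?_
    rw [Finset.sum_div, Finset.sum_mul]
    refine Finset.sum_congr rfl fun f hf => ?_
    have hed : (e : ℝ) * (d / e : ℕ) = d := by
      exact_mod_cast Nat.mul_div_cancel' (Nat.dvd_of_mem_divisors he)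
    have hf0 : (f : ℝ) ≠ 0 := by exact_mod_cast (Nat.pos_of_mem_divisors hf).ne'
    have : ((e * f : ℕ) : ℝ) * (d / e : ℕ) = d * f := by
      rw [← hed]; push_cast only [Nat.cast_mul]; ring
    rw [this]
    field_simp
  have hR : R n (κ * d) = ∑ e ∈ d.divisors, ∑ f ∈ (d / e).divisors,
      (moebius f : ℝ) * ((pairCount n (κ * (e * f)) (d / e) : ℝ) -
        pairCount n κ 1 / ((e * f : ℕ) * (d / e : ℕ))) +
      f d / d * ((pairCount n κ 1 : ℝ) - (oddBits n).card / κ) := by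
    simp only [mul_sub, Finset.sum_sub_distrib]
    rw [← hT, ← hM, R, hfκ]
    push_cast
    field_simp
    ring
  rw [hR, add_comm]
  refine (abs_add_le _ _).trans (add_le_add ?_ ?_)
  · have hf0 : 0 ≤ f d / d := div_nonneg (f_nonneg_of_squarefree hd) hd'.le
    rw [abs_mul, abs_of_nonneg hf0, mul_comm]
    exact mul_le_mul_of_nonneg_right (abs_pairCount_one_sub_le hn hκ) hf0
  · rw [Finset.mul_sum]
    refine (Finset.abs_sum_le_sum_abs _ _).trans (Finset.sum_le_sum fun e he => ?_)
    rw [Finset.mul_sum]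
    refine (Finset.abs_sum_le_sum_abs _ _).trans (Finset.sum_le_sum fun f hf => ?_)
    have hed := Nat.dvd_of_mem_divisors he
    have hef : e * f ∣ d := by
      obtain ⟨t, ht⟩ := Nat.dvd_of_mem_divisors hf
      exact ⟨t, by rw [mul_assoc, ← ht, Nat.mul_div_cancel' hed]⟩
    rw [abs_mul]
    have hmu : |(moebius f : ℝ)| ≤ 1 := by exact_mod_cast abs_moebius_le_one
    refine (mul_le_of_le_one_left (abs_nonneg _) hmu).trans ?_
    exact abs_pairCount_sub_le hn hκ0 (Nat.pos_of_dvd_of_pos hef hd0)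
      (Nat.div_pos (Nat.le_of_dvd hd0 hed) (Nat.pos_of_mem_divisors he))
      (Nat.Coprime.coprime_dvd_left hef h3)
      (Nat.Coprime.coprime_dvd_left (Nat.div_dvd_of_dvd hed) h3)

/-- The pair (κef, d/e) determines e and f. As κd is squarefree, κe is coprime to d/(ef), which
forces the lcm to be κd. -/
theorem sum_divisors_le_sum_lcm {N κ d : ℕ} (hκ : 0 < κ) (hd : Squarefree (κ * d))
    (hN : κ * d < N) (G : ℕ → ℕ → ℝ) (hG : ∀ q₁ q₂, 0 ≤ G q₁ q₂) :
    ∑ e ∈ d.divisors, ∑ f ∈ (d / e).divisors, G (κ * (e * f)) (d / e) ≤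
      ∑ q₁ ∈ Finset.Ico 1 N, ∑ q₂ ∈ Finset.Ico 1 N,
        if q₁.lcm q₂ = κ * d then G q₁ q₂ else 0 := by
  have hpos : 0 < κ * d := Nat.pos_of_ne_zero hd.ne_zero
  have hd0 : 0 < d := Nat.pos_of_mul_pos_left hpos
  rw [Finset.sum_sigma', ← Finset.sum_product' (Finset.Ico 1 N) (Finset.Ico 1 N)
    (fun q₁ q₂ => if q₁.lcm q₂ = κ * d then G q₁ q₂ else 0), ← Finset.sum_filter]
  set ψ : (Σ _ : ℕ, ℕ) → ℕ × ℕ := fun p => (κ * (p.1 * p.2), d / p.1) with hψ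
  have hinj : Set.InjOn ψ (d.divisors.sigma fun e => (d / e).divisors : Finset (Σ _ : ℕ, ℕ)) := by
    rintro ⟨e, f⟩ hp ⟨e', f'⟩ hp' h
    simp only [Finset.coe_sigma, Set.mem_sigma_iff, Finset.mem_coe] at hp hp'
    simp only [hψ, Prod.mk.injEq] at h
    have h1 : e = e' := by
      rw [← Nat.div_div_self (Nat.dvd_of_mem_divisors hp.1) hd0.ne',
        ← Nat.div_div_self (Nat.dvd_of_mem_divisors hp'.1) hd0.ne', h.2]
    subst h1
    have h2 := Nat.eq_of_mul_eq_mul_left (Nat.pos_of_mem_divisors hp.1)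
      (Nat.eq_of_mul_eq_mul_left hκ h.1)
    subst h2
    rfl
  rw [← Finset.sum_image (f := fun q : ℕ × ℕ => G q.1 q.2) (g := ψ) hinj]
  refine Finset.sum_le_sum_of_subset_of_nonneg ?_ fun _ _ _ => hG _ _
  intro q hq
  obtain ⟨⟨e, f⟩, hp, rfl⟩ := Finset.mem_image.1 hq
  simp only [Finset.mem_sigma] at hp
  obtain ⟨k, hk⟩ := Nat.dvd_of_mem_divisors hp.2
  have hdefk : d = e * (f * k) := by
    rw [← hk, Nat.mul_div_cancel' (Nat.dvd_of_mem_divisors hp.1)]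
  have hsq : Squarefree (κ * e * (f * k)) := by rwa [mul_assoc, ← hdefk]
  have hcop : (κ * e).Coprime k :=
    (Nat.coprime_of_squarefree_mul hsq).coprime_dvd_right (dvd_mul_left _ _)
  have hf0 : 0 < f := Nat.pos_of_mem_divisors hp.2
  have hlcm : (κ * (e * f)).lcm (d / e) = κ * d := by
    rw [hk, ← mul_assoc, mul_comm (κ * e) f, Nat.lcm_mul_left, hcop.lcm_eq_mul, hdefk]; ring
  have hl := Nat.dvd_lcm_left (κ * (e * f)) (d / e)
  have hr := Nat.dvd_lcm_right (κ * (e * f)) (d / e)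
  rw [hlcm] at hl hr
  simp only [hψ, Finset.mem_filter, Finset.mem_product, Finset.mem_Ico]
  exact ⟨⟨⟨Nat.pos_of_dvd_of_pos hl hpos, (Nat.le_of_dvd hpos hl).trans_lt hN⟩,
    Nat.pos_of_dvd_of_pos hr hpos, (Nat.le_of_dvd hpos hr).trans_lt hN⟩, hlcm⟩

theorem omegaPow_mul_abs_R_le {n d : ℕ} (hn : 1 ≤ n) (hd : Squarefree d) (h2 : Odd d)
    (hdn : d < 2 ^ n) :
    omegaPow 4 d * |R n d| ≤ 12 * (omegaPow 8 d / d) +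
      2 ^ n * ∑ q₁ ∈ Finset.Ico 1 (2 ^ n), ∑ q₂ ∈ Finset.Ico 1 (2 ^ n),
        if q₁.lcm q₂ = d then
          (omegaPow 4 (q₁.lcm q₂) : ℝ) / (q₁ * q₂) * divisorKernSum n q₁ q₂ else 0 := by
  obtain ⟨κ, m, hκ, h3, rfl⟩ : ∃ κ m : ℕ, (κ = 1 ∨ κ = 3) ∧ m.Coprime 3 ∧ d = κ * m := by
    by_cases h : 3 ∣ d
    · obtain ⟨m, rfl⟩ := h
      exact ⟨3, m, Or.inr rfl, (Nat.coprime_of_squarefree_mul hd).symm, rfl⟩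
    · exact ⟨1, d, Or.inl rfl, ((Nat.prime_three.coprime_iff_not_dvd).2 h).symm,
        (one_mul d).symm⟩
  have hκ0 : 0 < κ := by omega
  have hκ3 : (κ : ℝ) ≤ 3 := by rcases hκ with rfl | rfl <;> norm_num
  have hκ' : (0 : ℝ) < κ := by exact_mod_cast hκ0
  have hm2 := (Nat.odd_mul.1 h2).2
  have hmsq : Squarefree m := hd.squarefree_of_dvd (dvd_mul_left _ _)
  have hm' : (0 : ℝ) < m := by exact_mod_cast hm2.pos
  have hbound := abs_R_le hn hκ hmsq hm2 h3
  have hsum := sum_divisors_le_sum_lcm hκ0 hd hdn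
    (fun q₁ q₂ => divisorKernSum n q₁ q₂ / (q₁ * q₂))
    fun q₁ q₂ => div_nonneg (divisorKernSum_nonneg _ _ _) (by positivity)
  have hw8 : omegaPow 4 (κ * m) * omegaPow 2 m ≤ omegaPow 8 (κ * m) := by
    have h1 : omegaPow 2 m ≤ omegaPow 2 (κ * m) :=
      omegaPow_le_of_dvd (by norm_num) (dvd_mul_left _ _) hd.ne_zero
    refine (Nat.mul_le_mul_left _ h1).trans (le_of_eq ?_)
    unfold omegaPow
    rw [← mul_pow]; norm_num
  calc _ ≤ (omegaPow 4 (κ * m) : ℝ) * (4 * (f m / m) + 2 ^ n * ∑ q₁ ∈ Finset.Ico 1 (2 ^ n),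
        ∑ q₂ ∈ Finset.Ico 1 (2 ^ n),
        if q₁.lcm q₂ = κ * m then divisorKernSum n q₁ q₂ / (q₁ * q₂) else 0) := by
        refine mul_le_mul_of_nonneg_left (hbound.trans ?_) (Nat.cast_nonneg _)
        gcongr
    _ ≤ _ := by
        rw [mul_add]
        refine add_le_add ?_ (le_of_eq ?_)
        · calc _ ≤ (omegaPow 4 (κ * m) : ℝ) * (4 * (omegaPow 2 m / m)) := by
                gcongr; exact f_le_omegaPow hmsq
            _ = 4 * ((omegaPow 4 (κ * m) * omegaPow 2 m : ℕ) / m) := by push_cast; ring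
            _ ≤ 4 * ((omegaPow 8 (κ * m) : ℝ) / m) := by
                gcongr
            -- Passing from m to κm in the denominator costs κ ≤ 3.
            _ ≤ 4 * (3 * ((omegaPow 8 (κ * m) : ℝ) / (κ * m : ℕ))) := by
                refine mul_le_mul_of_nonneg_left ?_ (by norm_num)
                push_cast
                rw [← mul_div_assoc, div_le_div_iff₀ hm' (by positivity)]
                have : (0 : ℝ) ≤ omegaPow 8 (κ * m) * m := by positivity
                nlinarith
            _ = _ := by ring
        · rw [mul_left_comm, Finset.mul_sum]
          congr 1
          refine Finset.sum_congr rfl fun q₁ _ => ?_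
          rw [Finset.mul_sum]
          refine Finset.sum_congr rfl fun q₂ _ => ?_
          split_ifs with h
          · rw [h]; ring
          · rw [mul_zero]

open ArithmeticFunction in
theorem sum_weighted_R_le {n : ℕ} {ξ : ℝ} (hn : 1 ≤ n) (hξ : ξ < 1 / 2) :
    ∑ d ∈ oddBelow ((2 : ℝ) ^ (ξ * n)),
        (moebius d : ℝ) ^ 2 * (4 : ℝ) ^ (cardDistinctFactors d) * |R n d| ≤
      12 * omegaSum n 8 + 2 ^ n * ∑ q₁ ∈ Finset.Ico 1 (2 ^ n), ∑ q₂ ∈ Finset.Ico 1 (2 ^ n),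
        if Odd q₁ ∧ Odd q₂ ∧ ((q₁.lcm q₂ : ℕ) : ℝ) < 2 ^ (ξ * n) then
          (omegaPow 4 (q₁.lcm q₂) : ℝ) / (q₁ * q₂) * divisorKernSum n q₁ q₂ else 0 := by
  set D := oddBelow ((2 : ℝ) ^ (ξ * n)) with hD
  set G : ℕ → ℕ → ℝ := fun q₁ q₂ =>
    (omegaPow 4 (q₁.lcm q₂) : ℝ) / (q₁ * q₂) * divisorKernSum n q₁ q₂ with hG
  have hG0 : ∀ q₁ q₂, 0 ≤ G q₁ q₂ := fun q₁ q₂ =>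
    mul_nonneg (by positivity) (divisorKernSum_nonneg _ _ _)
  have hlt : ∀ d ∈ D, d < 2 ^ n := by
    intro d hd
    have h1 := ((mem_oddBelow _ _).1 hd).1
    have h2 : (2 : ℝ) ^ (ξ * n) ≤ 2 ^ (n : ℝ) := by
      refine Real.rpow_le_rpow_of_exponent_le one_le_two ?_
      have : (0 : ℝ) ≤ n := Nat.cast_nonneg _
      nlinarith
    rw [Real.rpow_natCast] at h2
    exact_mod_cast h1.trans_le h2
  have hterm : ∀ d ∈ D, (moebius d : ℝ) ^ 2 * (4 : ℝ) ^ (cardDistinctFactors d) * |R n d| ≤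
      12 * ((omegaPow 8 d : ℝ) / d) + 2 ^ n * ∑ q₁ ∈ Finset.Ico 1 (2 ^ n),
        ∑ q₂ ∈ Finset.Ico 1 (2 ^ n), if q₁.lcm q₂ = d then G q₁ q₂ else 0 := by
    intro d hd
    by_cases hsq : Squarefree d
    · refine le_trans (le_of_eq ?_)
        (omegaPow_mul_abs_R_le hn hsq ((mem_oddBelow _ _).1 hd).2 (hlt d hd))
      have h1 : (moebius d : ℝ) ^ 2 = 1 := by exact_mod_cast moebius_sq_eq_one_of_squarefree hsq
      have h2 : cardDistinctFactors d = d.primeFactors.card := by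
        rw [cardDistinctFactors_apply, Nat.primeFactors, List.card_toFinset]
      rw [h1, one_mul, h2, omegaPow]
      push_cast
      rfl
    · rw [moebius_eq_zero_of_not_squarefree hsq]
      simp only [Int.cast_zero, ne_eq, OfNat.ofNat_ne_zero, not_false_eq_true, zero_pow, zero_mul]
      have : 0 ≤ ∑ q₁ ∈ Finset.Ico 1 (2 ^ n),
        ∑ q₂ ∈ Finset.Ico 1 (2 ^ n), if q₁.lcm q₂ = d then G q₁ q₂ else 0 :=
        Finset.sum_nonneg fun q₁ _ => Finset.sum_nonneg fun q₂ _ => by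
          split_ifs
          · exact hG0 _ _
          · exact le_rfl
      positivity
  refine (Finset.sum_le_sum hterm).trans ?_
  rw [Finset.sum_add_distrib, ← Finset.mul_sum, ← Finset.mul_sum]
  refine add_le_add (mul_le_mul_of_nonneg_left ?_ (by norm_num))
    (mul_le_mul_of_nonneg_left ?_ (by positivity))
  · refine Finset.sum_le_sum_of_subset_of_nonneg ?_ fun _ _ _ => by positivity
    intro d hd
    exact Finset.mem_Ico.2 ⟨((mem_oddBelow _ _).1 hd).2.pos, hlt d hd⟩
  -- Each pair (q₁, q₂) has a single lcm, so it is met for at most one d.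
  · rw [Finset.sum_comm]
    refine Finset.sum_le_sum fun q₁ _ => ?_
    rw [Finset.sum_comm]
    refine Finset.sum_le_sum fun q₂ _ => ?_
    rw [Finset.sum_ite_eq]
    split_ifs with h1 h2 h2
    · exact le_rfl
    · have := (mem_oddBelow _ _).1 h1
      exact absurd ⟨this.2.of_dvd_nat (Nat.dvd_lcm_left _ _),
        this.2.of_dvd_nat (Nat.dvd_lcm_right _ _), this.1⟩ h2
    · exact hG0 _ _
    · exact le_rfl

/-! ### Choice of parameters and conclusion. -/

open Real in
theorem exists_pow_mul_exp_le {c : ℝ} (hc : 0 < c) :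
    ∃ C : ℝ, 0 < C ∧ ∀ n : ℕ, (n + 1 : ℝ) ^ 30 * exp (-(c * √n)) ≤ C := by
  refine ⟨(Nat.factorial 60 : ℝ) * exp c / c ^ 60, by positivity, fun n => ?_⟩
  have hs := Real.sqrt_nonneg (n : ℝ)
  have h1 : (n + 1 : ℝ) ≤ (1 + √n) ^ 2 := by
    nlinarith [Real.sq_sqrt (Nat.cast_nonneg (α := ℝ) n)]
  have h2 := Real.pow_div_factorial_le_exp (x := c * (1 + √n)) (by positivity) 60
  rw [div_le_iff₀ (by positivity), mul_pow, mul_add, mul_one, exp_add] at h2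
  have h3 : (n + 1 : ℝ) ^ 30 ≤ (1 + √n) ^ 60 :=
    (pow_le_pow_left₀ (by positivity) h1 30).trans (le_of_eq (by rw [← pow_mul]))
  rw [le_div_iff₀ (by positivity), exp_neg]
  calc _ ≤ (1 + √n) ^ 60 * (exp (c * √n))⁻¹ * c ^ 60 := by gcongr
    _ = (c ^ 60 * (1 + √n) ^ 60) * (exp (c * √n))⁻¹ := by ring
    _ ≤ (exp c * exp (c * √n) * (Nat.factorial 60 : ℝ)) * (exp (c * √n))⁻¹ := by gcongr
    _ = _ := by field_simp

open Real in
-- With η = 1/2 - ξ, the sieves leave about 2ηn digits. Half go to M and the rest absorbs the 7.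
-- Taking L near √n makes B = M/(2L) near η√n/2, the same order as L.
theorem exists_parameters {ξ : ℝ} (h0 : 0 < ξ) (h1 : ξ < 1 / 2) :
    ∃ n₀ : ℕ, ∀ n : ℕ, n₀ ≤ n → ∃ M L B : ℕ, (M : ℝ) + 7 + 2 * (ξ * n) ≤ n ∧ L ≤ M ∧
      2 * L * B ≤ M ∧ (1 / 2 - ξ) / 2 * √n - 2 ≤ (min L B : ℕ) := by
  set η := 1 / 2 - ξ with hη
  have hη0 : 0 < η := by linarith
  -- The three terms secure ηn ≥ 7, η√n ≥ 2 and √n ≥ 1.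
  obtain ⟨n₀, hn₀⟩ := exists_nat_ge (7 / η + (2 / η) ^ 2 + 1)
  refine ⟨n₀, fun n hn => ?_⟩
  have hn' : 7 / η + (2 / η) ^ 2 + 1 ≤ (n : ℝ) := hn₀.trans (by exact_mod_cast hn)
  have p1 : 0 < 7 / η := by positivity
  have p2 : 0 < (2 / η) ^ 2 := by positivity
  have e1 : 7 ≤ η * n := by
    have : 7 / η ≤ n := by linarith
    rw [div_le_iff₀ hη0] at this; linarith
  set s := √(n : ℝ) with hs
  have hsq : s * s = n := Real.mul_self_sqrt (Nat.cast_nonneg _)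
  have hs1 : 1 ≤ s := by
    rw [hs, Real.one_le_sqrt]; linarith
  have hs2 : 2 ≤ η * s := by
    have : 2 / η ≤ s := Real.le_sqrt_of_sq_le (by linarith)
    rw [div_le_iff₀ hη0] at this; linarith
  set M := ⌊η * n⌋₊ with hM
  set L := ⌊s⌋₊ with hL
  have hM1 : (M : ℝ) ≤ η * n := Nat.floor_le (by positivity)
  have hM2 : η * n < M + 1 := Nat.lt_floor_add_one _
  have hL1 : (L : ℝ) ≤ s := Nat.floor_le (by positivity)
  have hL2 : s < L + 1 := Nat.lt_floor_add_one _
  have hL0 : 0 < L := Nat.floor_pos.2 hs1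
  have e2 : ξ * n = n / 2 - η * n := by rw [hη]; ring
  refine ⟨M, L, M / (2 * L), by linarith, ?_, Nat.mul_div_le _ _, ?_⟩
  · exact Nat.floor_le_floor (by nlinarith)
  · rw [Nat.cast_min, le_min_iff]
    constructor
    · nlinarith
    · have hb : (M : ℝ) < 2 * L * ((M / (2 * L) : ℕ) + 1) := by
        have := Nat.lt_mul_div_succ M (show 0 < 2 * L by omega)
        exact_mod_cast this
      set B := M / (2 * L)
      have hB0 : (0 : ℝ) ≤ B := Nat.cast_nonneg _
      have h3 : (M : ℝ) < 2 * s * (B + 1) := hb.trans_le (by gcongr)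
      have h4 : η * (s * s) - 1 < 2 * s * (B + 1) := by rw [hsq]; linarith
      by_contra hcon
      push Not at hcon
      have h5 : 2 * s * (B + 1) < 2 * s * (η / 2 * s - 1) := by
        have : (B : ℝ) + 1 < η / 2 * s - 1 := by linarith
        gcongr
      nlinarith

open Real in
theorem sqrt_pow_le_exp {k : ℕ} {y : ℝ} (h : y ≤ k) :
    √((19 / 20) ^ k) ≤ exp (-(y / 40)) := by
  refine Real.sqrt_le_iff.2 ⟨(exp_pos _).le, ?_⟩
  rw [← exp_nat_mul]
  have h1 : (19 / 20 : ℝ) ≤ exp (-(1 / 20)) := by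
    have := add_one_le_exp (-(1 / 20) : ℝ); linarith
  calc (19 / 20 : ℝ) ^ k ≤ exp (-(1 / 20)) ^ k := by gcongr
    _ = exp (-(k / 20)) := by rw [← exp_nat_mul]; congr 1; ring
    _ ≤ _ := by
        rw [exp_le_exp]; push_cast; linarith

end ReversiblePrimes

theorem lemma1 (ξ : ℝ) (hξ_pos : 0 < ξ) (hξ_lt : ξ < 1 / 2) :
    ∃ c : ℝ, 0 < c ∧ ∃ C : ℝ, 0 < C ∧ ∀ n : ℕ, 1 ≤ n →
      ∑ d ∈ ReversiblePrimes.oddBelow ((2 : ℝ) ^ (ξ * (n : ℝ))),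
          (ArithmeticFunction.moebius d : ℝ) ^ 2 *
            (4 : ℝ) ^ (ArithmeticFunction.cardDistinctFactors d) * |ReversiblePrimes.R n d|
        ≤ C * ((2 : ℝ) ^ n * Real.exp (-c * Real.sqrt (n : ℝ))) := by
  open ReversiblePrimes in
  -- The saving is of size exp(-(1/2 - ξ)√n/80) = exp(-2c√n); half of the exponent absorbs (n +
  -- 1)^30.
  set c : ℝ := (1 / 2 - ξ) / 160 with hc
  have hc0 : 0 < c := by rw [hc]; linarith
  refine ⟨c, hc0, ?_⟩
  obtain ⟨n₀, hn₀⟩ := exists_parameters hξ_pos hξ_lt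
  obtain ⟨C₁, hC₁, hpoly⟩ := exists_pow_mul_exp_le hc0
  set S : ℕ → ℝ := fun n => ∑ d ∈ ReversiblePrimes.oddBelow ((2 : ℝ) ^ (ξ * (n : ℝ))),
          (ArithmeticFunction.moebius d : ℝ) ^ 2 *
            (4 : ℝ) ^ (ArithmeticFunction.cardDistinctFactors d) * |ReversiblePrimes.R n d| with hS
  have hS0 : ∀ n, 0 ≤ S n := fun n => Finset.sum_nonneg fun d _ => by positivity
  set w : ℕ → ℝ := fun n => (2 : ℝ) ^ n * Real.exp (-c * Real.sqrt (n : ℝ)) with hw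
  have hw0 : ∀ n, 0 < w n := fun n => by positivity
  set C₂ : ℝ := 4 * Real.exp Real.pi * √(2 * Real.exp Real.pi) * Real.exp (1 / 20) with hC₂
  have hC₂0 : 0 ≤ C₂ := by positivity
  -- The finite sum covers the n below n₀, where the parameters need not exist.
  refine ⟨(12 + C₂) * C₁ + ∑ k ∈ Finset.range n₀, S k / w k, ?_, fun n hn => ?_⟩
  · have : 0 ≤ ∑ k ∈ Finset.range n₀, S k / w k :=
      Finset.sum_nonneg fun k _ => div_nonneg (hS0 k) (hw0 k).le
    positivity
  change S n ≤ _ * w n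
  rcases lt_or_ge n n₀ with hlt | hge
  · have h1 : S n / w n ≤ ∑ k ∈ Finset.range n₀, S k / w k :=
      Finset.single_le_sum (f := fun k => S k / w k)
        (fun k _ => div_nonneg (hS0 k) (hw0 k).le) (Finset.mem_range.2 hlt)
    rw [← div_le_iff₀ (hw0 n)]
    have : 0 ≤ (12 + C₂) * C₁ := by positivity
    linarith
  · obtain ⟨M, L, B, hM, hL, hB, hmin⟩ := hn₀ n hge
    have h1 : S n ≤ _ := sum_weighted_R_le hn hξ_lt
    have h2 := sum_divisorKernSum_le hM hL hB
    have h3 : √((19 / 20) ^ min L B) ≤ Real.exp (1 / 20) * Real.exp (-(2 * c * √n)) := by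
      refine (sqrt_pow_le_exp hmin).trans (le_of_eq ?_)
      rw [← Real.exp_add]
      congr 1
      rw [hc]; ring
    have h4 : omegaSum n 8 ≤ (n + 1 : ℝ) ^ 30 := by
      refine (omegaSum_two_pow_le n 3).trans ?_
      have : (1 : ℝ) ≤ n + 1 := by
        have : (0 : ℝ) ≤ n := Nat.cast_nonneg _
        linarith
      exact pow_le_pow_right₀ this (by norm_num)
    have h5 : 1 ≤ (2 : ℝ) ^ n * Real.exp (-(2 * c * √n)) := by
      have e1 : (2 : ℝ) ^ n = Real.exp (n * Real.log 2) := by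
        rw [Real.exp_nat_mul, Real.exp_log two_pos]
      rw [e1, ← Real.exp_add]
      refine Real.one_le_exp ?_
      have hsn : √(n : ℝ) ≤ n := by
        have hn1 : (1 : ℝ) ≤ n := by exact_mod_cast hn
        rw [Real.sqrt_le_left (by linarith)]
        nlinarith
      have hlog := Real.log_two_gt_d9
      have hs0 := Real.sqrt_nonneg (n : ℝ)
      have hc1 : 2 * c ≤ 1 / 2 := by rw [hc]; linarith
      have a1 : 2 * c * √n ≤ 1 / 2 * n := by gcongr
      have a2 : (1 / 2 : ℝ) * n ≤ Real.log 2 * n := by gcongr; linarith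
      linarith
    have h6 : Real.exp (-(2 * c * √n)) = Real.exp (-(c * √n)) * Real.exp (-c * √n) := by
      rw [← Real.exp_add]; ring_nf
    have h7 : 0 ≤ ∑ k ∈ Finset.range n₀, S k / w k :=
      Finset.sum_nonneg fun k _ => div_nonneg (hS0 k) (hw0 k).le
    calc S n ≤ 12 * (n + 1 : ℝ) ^ 30 * (2 ^ n * Real.exp (-(2 * c * √n))) +
          2 ^ n * (4 * Real.exp Real.pi * √(2 * Real.exp Real.pi) * (n + 1) ^ 30 *
            (Real.exp (1 / 20) * Real.exp (-(2 * c * √n)))) := by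
          refine h1.trans (add_le_add ?_ ?_)
          · calc 12 * omegaSum n 8 ≤ 12 * (n + 1 : ℝ) ^ 30 * 1 := by linarith
              _ ≤ _ := by gcongr
          · exact mul_le_mul_of_nonneg_left (h2.trans (by gcongr)) (by positivity)
      _ = (12 + C₂) * ((n + 1 : ℝ) ^ 30 * Real.exp (-(c * √n))) * w n := by
          rw [h6, hC₂, hw]; ring
      _ ≤ (12 + C₂) * C₁ * w n := by
          have := hpoly n
          have := (hw0 n).le
          gcongr
      _ ≤ _ := by
          have := (hw0 n).le
          gcongr
          linarith
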